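/- Let $\alpha\in(1,2]$, let $J(0)=0$ and $J(r)=r^{-\alpha}$ for integers $r\ge 1$, and let $h:\mathbb Z\to\mathbb R_{\ge 0}$. For a finite set $A\subset\mathbb Z$ let $\widehat h_x=h_x$ if $x\notin A$ and $\widehat h_x=0$ if $x\in A$. For $\omega\in\{+1,-1\}$ and $L\in\mathbb N$, let $\Omega_L^{\omega}$ be the (finite) set of $\sigma\in\{-1,+1\}^{\mathbb Z}$ with $\sigma_x=\omega$ for all $x\notin[-L,L]$, and for $\sigma\in\Omega_L^\omega$ put $$H^{\omega}_{\widehat h}(\sigma)=\sum_{x<y}J(|x-y|)(1-\sigma_x\sigma_y)+\sum_{x}\widehat h_x(\omega-\sigma_x),\qquad \langle f\rangle^{\omega}_{\alpha,\widehat h,\beta,L}=\frac{\sum_{\sigma\in\Omega_L^\omega}f(\sigma)e^{-\beta H^\omega_{\widehat h}(\sigma)}}{\sum_{\sigma\in\Omega_L^\omega}e^{-\beta H^\omega_{\widehat h}(\sigma)}} .$$ The states $\langle\cdot\rangle^{\pm}_{\alpha,\widehat h,\beta}$ are given by $\langle f\rangle^{\pm}_{\alpha,\widehat h,\beta}=\lim_{L\to\infty}\langle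 f\rangle^{\pm1}_{\alpha,\widehat h,\beta,L}$ for functions $f$ of finitely many spins. **Theorem.** Suppose that there exist a finite set $A\subset\mathbb Z$ and $\eta\in(0,1)$ such that $$\eta\sum_{x\in\Lambda,\;y\in\Lambda^c}|x-y|^{-\alpha}\;\ge\;\sum_{x\in\Lambda}\widehat h_x\qquad\text{for every finite }\Lambda\subset\mathbb Z .$$ Then there is $\bar\beta>0$, depending only on $J$ and $\widehat h$, such that for every $\beta\ge\bar\beta$ the limits defining $\langle\cdot\rangle^{+}_{\alpha,\widehat h,\beta}$ and $\langle\cdot\rangle^{-}_{\alpha,\widehat h,\beta}$ exist and $$\langle\sigma_0\rangle^{-}_{\alpha,\widehat h,\beta}\neq\langle\sigma_0\rangle^{+}_{\alpha,\widehat h,\beta},$$ that is, there is a phase transition. -/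

import Mathlib

namespace LongRangeIsing

/-- Spin configurations on the integers; `ℤˣ = {1, -1}` is the spin space. -/
abbrev Config : Type := ℤ → ℤˣ

/-- The real value `±1` of the spin at `x`. -/
def spin (x : ℤ) (σ : Config) : ℝ := ((σ x : ℤ) : ℝ)

/-- The coupling `J(r) = r ^ (-α)` for `r > 0` and `J(0) = 0`. -/
noncomputable def coupling (α : ℝ) (r : ℕ) : ℝ := if r = 0 then 0 else (r : ℝ) ^ (-α)

/-- The truncated field: equal to `h` off the finite set `A` and to `0` on `A`. -/
def truncate (h : ℤ → ℝ) (A : Finset ℤ) : ℤ → ℝ := fun x => if x ∈ A then 0 else h x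

/-- The box `[-L, L]`. -/
noncomputable def box (L : ℕ) : Finset ℤ := Finset.Icc (-(L : ℤ)) (L : ℤ)

/-- Configurations with boundary condition `ω` (that is `+` for `1` and `-` for `-1`):
those which are equal to `ω` everywhere outside `[-L, L]`. -/
def boxConfigs (ω : ℤˣ) (L : ℕ) : Set Config := {σ | ∀ x, x ∉ box L → σ x = ω}

theorem boxConfigs_finite (ω : ℤˣ) (L : ℕ) : (boxConfigs ω L).Finite := by
  refine Set.Finite.of_finite_image
    (f := fun (σ : Config) (x : box L) => σ x) (Set.toFinite _) ?_
  intro σ hσ τ hτ hst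
  funext x
  by_cases hx : x ∈ box L
  · exact congrFun hst ⟨x, hx⟩
  · rw [hσ x hx, hτ x hx]

/-- The Hamiltonian with boundary condition `ω`,
`∑_{x < y} J(|x - y|) (1 - σ_x σ_y) + ∑_x h_x (ω - σ_x)`.
The field term is `∑_x h_x (1 - σ_x)` for `ω = 1` and `-∑_x h_x (1 + σ_x)` for `ω = -1`.
For `1 < α` both series converge absolutely at every `σ` in `boxConfigs ω L`. -/
noncomputable def hamiltonian (α : ℝ) (h : ℤ → ℝ) (ω : ℤˣ) (σ : Config) : ℝ :=
  (∑' p : {p : ℤ × ℤ // p.1 < p.2},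
      coupling α (p.1.1 - p.1.2).natAbs * (1 - spin p.1.1 σ * spin p.1.2 σ))
    + ∑' x : ℤ, h x * (((ω : ℤ) : ℝ) - spin x σ)

/-- The partition function in `[-L, L]` with boundary condition `ω`. -/
noncomputable def partitionFunction (α : ℝ) (h : ℤ → ℝ) (β : ℝ) (ω : ℤˣ) (L : ℕ) : ℝ :=
  ∑ σ ∈ (boxConfigs_finite ω L).toFinset, Real.exp (-β * hamiltonian α h ω σ)

/-- The expectation of `f` under the finite-volume Gibbs measure in `[-L, L]` at inverse
temperature `β` with boundary condition `ω`. -/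
noncomputable def gibbsExpectation (α : ℝ) (h : ℤ → ℝ) (β : ℝ) (ω : ℤˣ) (L : ℕ)
    (f : Config → ℝ) : ℝ :=
  (1 / partitionFunction α h β ω L) *
    ∑ σ ∈ (boxConfigs_finite ω L).toFinset, f σ * Real.exp (-β * hamiltonian α h ω σ)

/-- A local observable: a function of finitely many spins. -/
def IsLocal (f : Config → ℝ) : Prop := ∃ Λ : Finset ℤ, DependsOn f (Λ : Set ℤ)

/-- `S` is the infinite-volume state with boundary condition `ω`: on every local observable it
is the limit, as `L → ∞`, of the finite-volume expectations in `[-L, L]`.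
(This determines `S` on local observables; its other values play no role.) -/
def IsBoundaryState (α : ℝ) (h : ℤ → ℝ) (β : ℝ) (ω : ℤˣ) (S : (Config → ℝ) → ℝ) : Prop :=
  ∀ f : Config → ℝ, IsLocal f →
    Filter.Tendsto (fun L : ℕ => gibbsExpectation α h β ω L f) Filter.atTop (nhds (S f))

end LongRangeIsing

namespace LongRangeIsing

open scoped ENNReal
open MeasureTheory

/-! ### Regions enclosed by finite sets of boundary points -/

/-- The region enclosed by a finite set `γ` of boundary points, where `p` stands for the bond
between `p` and `p + 1`. -/
def vol (γ : Finset ℤ) : Set ℤ := {x | Odd (γ.filter (· < x)).card}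

/-- The ordered pairs of sites separated by `V`. -/
def cut (V : Set ℤ) : Set (ℤ × ℤ) := {p | ¬(p.1 ∈ V ↔ p.2 ∈ V)}

theorem swap_mem_cut {V : Set ℤ} {x y : ℤ} : (y, x) ∈ cut V ↔ (x, y) ∈ cut V := by
  simp only [cut, Set.mem_ofPred_eq]; tauto

theorem card_filter_lt_of_le (γ : Finset ℤ) {x y : ℤ} (hxy : x ≤ y) :
    (γ.filter (· < y)).card =
      (γ.filter (· < x)).card + (γ.filter fun r => x ≤ r ∧ r < y).card := by
  rw [← Finset.card_union_of_disjoint]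
  · congr 1
    ext r
    simp only [Finset.mem_filter, Finset.mem_union]
    grind
  · rw [Finset.disjoint_filter]
    intro r _ h1 h2
    omega

theorem mem_cut_vol_iff (γ : Finset ℤ) {x y : ℤ} (hxy : x ≤ y) :
    (x, y) ∈ cut (vol γ) ↔ Odd (γ.filter fun r => x ≤ r ∧ r < y).card := by
  simp only [cut, vol, Set.mem_ofPred_eq, card_filter_lt_of_le γ hxy, Nat.odd_add,
    ← Nat.not_odd_iff_even]
  tauto

theorem exists_between_of_mem_cut_vol {γ : Finset ℤ} {x y : ℤ} (h : (x, y) ∈ cut (vol γ)) :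
    ∃ r ∈ γ, (x ≤ r ∧ r < y) ∨ (y ≤ r ∧ r < x) := by
  rcases le_total x y with hxy | hxy
  · rw [mem_cut_vol_iff γ hxy] at h
    obtain ⟨r, hr⟩ := Finset.card_pos.1 h.pos
    exact ⟨r, (Finset.mem_filter.1 hr).1, Or.inl (Finset.mem_filter.1 hr).2⟩
  · rw [← swap_mem_cut, mem_cut_vol_iff γ hxy] at h
    obtain ⟨r, hr⟩ := Finset.card_pos.1 h.pos
    exact ⟨r, (Finset.mem_filter.1 hr).1, Or.inr (Finset.mem_filter.1 hr).2⟩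

theorem mem_vol_iff_of_no_between {γ : Finset ℤ} {x y : ℤ}
    (h : ∀ r ∈ γ, ¬((x ≤ r ∧ r < y) ∨ (y ≤ r ∧ r < x))) : x ∈ vol γ ↔ y ∈ vol γ := by
  by_contra hc
  obtain ⟨r, hr, hb⟩ := exists_between_of_mem_cut_vol (γ := γ) (x := x) (y := y) hc
  exact h r hr hb

theorem exists_lt_of_mem_vol {γ : Finset ℤ} {x : ℤ} (h : x ∈ vol γ) : ∃ p ∈ γ, p < x := by
  obtain ⟨r, hr⟩ := Finset.card_pos.1 (show Odd (γ.filter (· < x)).card from h).pos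
  exact ⟨r, (Finset.mem_filter.1 hr).1, (Finset.mem_filter.1 hr).2⟩

theorem exists_ge_of_mem_vol {γ : Finset ℤ} (hγ : Even γ.card) {x : ℤ} (h : x ∈ vol γ) :
    ∃ p ∈ γ, x ≤ p := by
  by_contra! hc
  have : γ.filter (· < x) = γ := Finset.filter_true_of_mem hc
  simp only [vol, Set.mem_ofPred_eq, this] at h
  exact Nat.not_even_iff_odd.2 h hγ

theorem notMem_vol_of_forall_ge {γ : Finset ℤ} {x : ℤ} (h : ∀ p ∈ γ, x ≤ p) : x ∉ vol γ := by
  intro hx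
  obtain ⟨p, hp, hpx⟩ := exists_lt_of_mem_vol hx
  have := h p hp
  omega

/-- The boundary points of a finite set of sites. -/
noncomputable def boundary (Λ : Finset ℤ) : Finset ℤ :=
  open Classical in
  (Λ ∪ Λ.image (· - 1)).filter fun p => ¬(p ∈ Λ ↔ p + 1 ∈ Λ)

theorem mem_boundary {Λ : Finset ℤ} {p : ℤ} : p ∈ boundary Λ ↔ ¬(p ∈ Λ ↔ p + 1 ∈ Λ) := by
  simp only [boundary, Finset.mem_filter, Finset.mem_union, Finset.mem_image]
  constructor
  · exact fun h => h.2
  · intro h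
    refine ⟨?_, h⟩
    by_cases hp : p ∈ Λ
    · exact Or.inl hp
    · right
      refine ⟨p + 1, by tauto, by ring⟩

theorem vol_boundary (Λ : Finset ℤ) : vol (boundary Λ) = (Λ : Set ℤ) := by
  obtain ⟨a, ha⟩ : ∃ a : ℤ, ∀ x ∈ Λ, a < x := by
    obtain ⟨a, ha⟩ := Λ.finite_toSet.bddBelow
    exact ⟨a - 1, fun x hx => by have := ha hx; omega⟩
  have hlow : ∀ x, x ≤ a → x ∉ Λ := fun x hx h => by have := ha x h; omega
  have key : ∀ n : ℕ, (a + n ∈ vol (boundary Λ) ↔ a + n ∈ Λ) := by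
    intro n
    induction n with
    | zero =>
      have : (a : ℤ) + (0 : ℕ) ∉ vol (boundary Λ) := by
        apply notMem_vol_of_forall_ge
        intro p hp
        by_contra hc
        rw [mem_boundary] at hp
        have h1 := hlow p (by omega)
        have h2 := hlow (p + 1) (by push_cast at hc; omega)
        tauto
      have h2 := hlow (a + (0 : ℕ)) (by simp)
      tauto
    | succ n ih =>
      have hc := mem_cut_vol_iff (boundary Λ) (x := a + n) (y := a + (n + 1 : ℕ))
        (by push_cast; omega)
      have hf : (boundary Λ).filter (fun r => a + (n : ℤ) ≤ r ∧ r < a + (n + 1 : ℕ)) =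
          if a + (n : ℤ) ∈ boundary Λ then {a + (n : ℤ)} else ∅ := by
        ext r
        split_ifs with h
        · simp only [Finset.mem_filter, Finset.mem_singleton]
          constructor
          · rintro ⟨_, h1, h2⟩; push_cast at h2; omega
          · rintro rfl; exact ⟨h, le_rfl, by push_cast; omega⟩
        · simp only [Finset.mem_filter, Finset.notMem_empty, iff_false]
          rintro ⟨h0, h1, h2⟩
          have : r = a + n := by push_cast at h2; omega
          exact h (this ▸ h0)
      rw [hf] at hc
      have e : (a + (n : ℤ)) + 1 = a + (n + 1 : ℕ) := by push_cast; ring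
      by_cases hb : a + (n : ℤ) ∈ boundary Λ
      · rw [if_pos hb] at hc
        rw [mem_boundary, e] at hb
        have : (a + (n : ℤ), a + ((n + 1 : ℕ) : ℤ)) ∈ cut (vol (boundary Λ)) := hc.2 (by simp)
        simp only [cut, Set.mem_ofPred_eq] at this
        tauto
      · rw [if_neg hb] at hc
        rw [mem_boundary, e] at hb
        have : (a + (n : ℤ), a + ((n + 1 : ℕ) : ℤ)) ∉ cut (vol (boundary Λ)) := by
          rw [hc]; simp
        simp only [cut, Set.mem_ofPred_eq] at this
        tauto
  ext x
  rcases le_total x a with hx | hx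
  · have h1 := hlow x hx
    have h2 : x ∉ vol (boundary Λ) := by
      apply notMem_vol_of_forall_ge
      intro p hp
      by_contra hc
      rw [mem_boundary] at hp
      have h1 := hlow p (by omega)
      have h2 := hlow (p + 1) (by omega)
      tauto
    simp [h1, h2]
  · obtain ⟨n, hn⟩ := Int.eq_ofNat_of_zero_le (sub_nonneg.2 hx)
    have := key n
    rw [show a + (n : ℤ) = x by omega] at this
    simpa using this

theorem even_card_boundary (Λ : Finset ℤ) : Even (boundary Λ).card := by
  by_contra h
  rw [Nat.not_even_iff_odd] at h
  obtain ⟨b, hb⟩ := (boundary Λ ∪ Λ).finite_toSet.bddAbove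
  have hmem : b + 1 ∈ vol (boundary Λ) := by
    have : (boundary Λ).filter (· < b + 1) = boundary Λ := by
      apply Finset.filter_true_of_mem
      intro p hp
      have := hb (show p ∈ ((boundary Λ ∪ Λ : Finset ℤ) : Set ℤ) by simp [hp])
      omega
    rw [vol, Set.mem_ofPred_eq, this]
    exact h
  rw [vol_boundary] at hmem
  have := hb (show b + 1 ∈ ((boundary Λ ∪ Λ : Finset ℤ) : Set ℤ) by
    simp at hmem; simp [hmem])
  omega

/-! ### Peeling off isolated clusters -/

/-- The isolation distance required of clusters of diameter at most `2 ^ m`. -/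
def reach (k m : ℕ) : ℤ := 2 ^ (m + m / 4 + k)

theorem reach_mono (k : ℕ) {m n : ℕ} (h : m ≤ n) : reach k m ≤ reach k n := by
  unfold reach
  gcongr
  norm_num

theorem two_pow_mul_le_reach (k m : ℕ) : (2 : ℤ) ^ m * 2 ^ k ≤ reach k m := by
  rw [reach, ← pow_add]
  gcongr
  · norm_num
  · omega

/-- `C` is an even cluster of `B` of diameter at most `2 ^ m`, far from the rest of `B`. -/
structure IsCluster (k m : ℕ) (B C : Finset ℤ) : Prop where
  subset : C ⊆ B
  nonempty : C.Nonempty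
  even : Even C.card
  diam : ∀ p ∈ C, ∀ q ∈ C, |p - q| ≤ 2 ^ m
  sep : ∀ p ∈ C, ∀ q ∈ B, q ∉ C → reach k m ≤ |p - q|

theorem IsCluster.eq_of_mem {k m : ℕ} (hk : 1 ≤ k) {B C C' : Finset ℤ} (h : IsCluster k m B C)
    (h' : IsCluster k m B C') {p : ℤ} (hp : p ∈ C) (hp' : p ∈ C') : C = C' := by
  have hlt : (2 : ℤ) ^ m < reach k m := by
    have h1 := two_pow_mul_le_reach k m
    have h2 : (2 : ℤ) ^ 1 ≤ 2 ^ k := pow_le_pow_right₀ (by norm_num) hk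
    have h3 : (0 : ℤ) < 2 ^ m := by positivity
    nlinarith
  apply Finset.Subset.antisymm
  · intro q hq
    by_contra hc
    have := h'.sep p hp' q (h.subset hq) hc
    have := h.diam p hp q hq
    omega
  · intro q hq
    by_contra hc
    have := h.sep p hp q (h'.subset hq) hc
    have := h'.diam p hp' q hq
    omega

open Classical in
/-- The clusters of `B` at scale `m`. -/
noncomputable def clusters (k m : ℕ) (B : Finset ℤ) : Finset (Finset ℤ) :=
  B.powerset.filter (IsCluster k m B)

theorem mem_clusters {k m : ℕ} {B C : Finset ℤ} : C ∈ clusters k m B ↔ IsCluster k m B C := by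
  simp only [clusters, Finset.mem_filter, Finset.mem_powerset, and_iff_right_iff_imp]
  exact fun h => h.subset

/-- What remains of `B` after the clusters of the scales below `m` are removed successively. -/
noncomputable def peel (k : ℕ) (B : Finset ℤ) : ℕ → Finset ℤ
  | 0 => B
  | m + 1 => peel k B m \ (clusters k m (peel k B m)).biUnion id

theorem peel_succ_subset (k : ℕ) (B : Finset ℤ) (m : ℕ) : peel k B (m + 1) ⊆ peel k B m :=
  Finset.sdiff_subset

theorem peel_antitone (k : ℕ) (B : Finset ℤ) : Antitone (peel k B) :=
  antitone_nat_of_succ_le (peel_succ_subset k B)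

theorem IsCluster.disjoint_peel_succ {k m : ℕ} {B C : Finset ℤ} (h : IsCluster k m (peel k B m) C)
    {p : ℤ} (hp : p ∈ C) : p ∉ peel k B (m + 1) := by
  simp only [peel, Finset.mem_sdiff, Finset.mem_biUnion, id, not_and, not_not]
  exact fun _ => ⟨C, mem_clusters.2 h, hp⟩

theorem card_filter_peel {k : ℕ} (hk : 1 ≤ k) (B : Finset ℤ) (m : ℕ) (P : ℤ → Prop)
    [DecidablePred P] :
    ((peel k B m).filter P).card = ((peel k B (m + 1)).filter P).card +
      ∑ C ∈ clusters k m (peel k B m), (C.filter P).card := by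
  have hU : (clusters k m (peel k B m)).biUnion id ⊆ peel k B m := by
    intro p hp
    simp only [Finset.mem_biUnion, id] at hp
    obtain ⟨C, hC, hpC⟩ := hp
    exact (mem_clusters.1 hC).subset hpC
  rw [← Finset.card_biUnion]
  · rw [← Finset.card_union_of_disjoint]
    · congr 1
      ext r
      simp only [peel, Finset.mem_filter, Finset.mem_union, Finset.mem_sdiff, Finset.mem_biUnion,
        id]
      constructor
      · rintro ⟨h1, h2⟩
        by_cases h : ∃ a ∈ clusters k m (peel k B m), r ∈ a
        · obtain ⟨a, ha, hr⟩ := h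
          exact Or.inr ⟨a, ha, hr, h2⟩
        · exact Or.inl ⟨⟨h1, h⟩, h2⟩
      · rintro (⟨⟨h1, _⟩, h2⟩ | ⟨a, ha, hr, h2⟩)
        · exact ⟨h1, h2⟩
        · exact ⟨(mem_clusters.1 ha).subset hr, h2⟩
    · rw [Finset.disjoint_left]
      intro r hr hr'
      simp only [Finset.mem_biUnion, Finset.mem_filter] at hr hr'
      obtain ⟨a, ha, hra, _⟩ := hr'
      exact (mem_clusters.1 ha).disjoint_peel_succ hra hr.1
  · intro C hC C' hC' hne
    rw [Function.onFun, Finset.disjoint_left]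
    intro r hr hr'
    exact hne ((mem_clusters.1 hC).eq_of_mem hk (mem_clusters.1 hC') (Finset.mem_filter.1 hr).1
      (Finset.mem_filter.1 hr').1)

theorem even_card_peel {k : ℕ} (hk : 1 ≤ k) {B : Finset ℤ} (hB : Even B.card) (m : ℕ) :
    Even (peel k B m).card := by
  induction m with
  | zero => exact hB
  | succ m ih =>
    have h := card_filter_peel hk B m (fun _ => True)
    simp only [Finset.filter_true] at h
    have hs : Even (∑ C ∈ clusters k m (peel k B m), C.card) :=
      Finset.even_sum _ fun C hC => (mem_clusters.1 hC).even
    rw [h, Nat.even_add] at ih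
    exact ih.2 hs

/-- Every odd part of an even set of boundary points is odd in some peeled cluster. -/
theorem exists_cluster_odd_filter {k : ℕ} (hk : 1 ≤ k) {B : Finset ℤ} (hB : Even B.card)
    (P : ℤ → Prop) [DecidablePred P] (hP : Odd (B.filter P).card) :
    ∃ n γ, IsCluster k n (peel k B n) γ ∧ Odd (γ.filter P).card := by
  by_contra! hc
  have hodd : ∀ n, Odd ((peel k B n).filter P).card := by
    intro n
    induction n with
    | zero => exact hP
    | succ n ih =>
      rw [card_filter_peel hk B n P, Nat.odd_add] at ih
      refine ih.2 (Finset.even_sum _ fun C hC => ?_)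
      exact Nat.not_odd_iff_even.1 (hc n C (mem_clusters.1 hC))
  obtain ⟨n, hn⟩ : ∃ n : ℕ, ∀ p ∈ B, ∀ q ∈ B, |p - q| ≤ 2 ^ n := by
    have hb := ((B ×ˢ B).image fun x => (x.1 - x.2).natAbs).finite_toSet.bddAbove
    obtain ⟨n, hn⟩ := hb
    refine ⟨n, fun p hp q hq => ?_⟩
    have h1 : (p - q).natAbs ≤ n := hn (by
      simp only [Finset.coe_image, Set.mem_image, Finset.mem_coe, Finset.mem_product]
      exact ⟨(p, q), ⟨hp, hq⟩, rfl⟩)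
    have h2 : n < 2 ^ n := Nat.lt_two_pow_self
    have h3 : (n : ℤ) < 2 ^ n := by exact_mod_cast h2
    have h4 : |p - q| = ((p - q).natAbs : ℤ) := (Int.natCast_natAbs _).symm
    rw [h4]
    exact (Int.ofNat_le.2 h1).trans h3.le
  have hsub : peel k B n ⊆ B := peel_antitone k B (Nat.zero_le n)
  refine hc n (peel k B n) ⟨subset_rfl, ?_, even_card_peel hk hB n, ?_, ?_⟩ (hodd n)
  · obtain ⟨r, hr⟩ := Finset.card_pos.1 (hodd n).pos
    exact ⟨r, (Finset.mem_filter.1 hr).1⟩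
  · exact fun p hp q hq => hn p (hsub hp) q (hsub hq)
  · exact fun p _ q hq hq' => absurd hq hq'

/-- A peeled cluster has no clusters of smaller scales. -/
theorem IsCluster.irreducible {k : ℕ} {B γ : Finset ℤ} {n : ℕ}
    (h : IsCluster k n (peel k B n) γ) {m : ℕ} (hm : m < n) (C : Finset ℤ) :
    ¬IsCluster k m γ C := by
  intro hC
  have hsub : C ⊆ peel k B n := hC.subset.trans h.subset
  have hnot : ¬IsCluster k m (peel k B m) C := by
    intro hC'
    obtain ⟨p, hp⟩ := hC.nonempty
    exact hC'.disjoint_peel_succ hp (peel_antitone k B hm (hsub hp))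
  obtain ⟨p, hp, q, hq, hqC, hlt⟩ : ∃ p ∈ C, ∃ q ∈ peel k B m, q ∉ C ∧ |p - q| < reach k m := by
    by_contra! hc
    exact hnot ⟨hsub.trans (peel_antitone k B hm.le), hC.nonempty, hC.even, hC.diam, hc⟩
  have hstay : ∀ j, m ≤ j → j ≤ n → q ∈ peel k B j := by
    intro j hj
    induction j, hj using Nat.le_induction with
    | base => exact fun _ => hq
    | succ j hj ih =>
      intro hjn
      have hqj := ih (by omega)
      by_contra hc
      simp only [peel, Finset.mem_sdiff, Finset.mem_biUnion, id, not_and, not_not] at hc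
      obtain ⟨C', hC', hqC'⟩ := hc hqj
      have hC'' := mem_clusters.1 hC'
      have hpC' : p ∉ C' := fun hp' =>
        hC''.disjoint_peel_succ hp' (peel_antitone k B hjn (hsub hp))
      have h1 := hC''.sep q hqC' p (peel_antitone k B (by omega : j ≤ n) (hsub hp)) hpC'
      have h2 := reach_mono k hj
      rw [abs_sub_comm] at h1
      omega
  by_cases hqγ : q ∈ γ
  · have := hC.sep p hp q hqγ hqC
    omega
  · have h1 := h.sep p (hC.subset hp) q (hstay n hm.le le_rfl) hqγ
    have h2 := reach_mono k hm.le
    omega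

/-- If an odd part of what is left of `B` without the peeled cluster `γ` is given, it is odd in a
cluster peeled at an earlier scale or in the set which `γ` is peeled off from. -/
theorem odd_filter_sdiff {k : ℕ} (hk : 1 ≤ k) {B γ : Finset ℤ} {n : ℕ} (hγ : γ ⊆ peel k B n)
    (P : ℤ → Prop) [DecidablePred P] (hP : Odd ((B \ γ).filter P).card) :
    (∃ m < n, ∃ C, IsCluster k m (peel k B m) C ∧ Odd (C.filter P).card) ∨
      Odd ((peel k B n \ γ).filter P).card := by
  by_contra! hc
  obtain ⟨hc1, hc2⟩ := hc
  have hodd : ∀ m ≤ n, Odd ((peel k B m \ γ).filter P).card := by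
    intro m hm
    induction m with
    | zero => exact hP
    | succ m ih =>
      have ih := ih (by omega)
      have hsplit : ∀ D : Finset ℤ, γ ⊆ D →
          (D.filter P).card = ((D \ γ).filter P).card + (γ.filter P).card := by
        intro D hD
        rw [← Finset.card_union_of_disjoint]
        · rw [← Finset.filter_union, Finset.sdiff_union_of_subset hD]
        · exact Finset.disjoint_filter_filter Finset.sdiff_disjoint
      have h1 := hsplit _ (hγ.trans (peel_antitone k B (by omega : m ≤ n)))
      have h2 := hsplit _ (hγ.trans (peel_antitone k B hm))
      have h3 := card_filter_peel hk B m P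
      have h4 : ((peel k B m \ γ).filter P).card = ((peel k B (m + 1) \ γ).filter P).card +
          ∑ C ∈ clusters k m (peel k B m), (C.filter P).card := by omega
      rw [h4, Nat.odd_add] at ih
      refine ih.2 (Finset.even_sum _ fun C hC => ?_)
      exact Nat.not_odd_iff_even.1 (hc1 m (by omega) C (mem_clusters.1 hC))
  exact hc2 (hodd n le_rfl)

/-! ### The bond measure -/

/-- The coupling between two sites, as an extended nonnegative real. -/
noncomputable def bond (α : ℝ) (p : ℤ × ℤ) : ℝ≥0∞ :=
  ENNReal.ofReal (coupling α (p.1 - p.2).natAbs)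

/-- The measure on ordered pairs of sites whose density is the coupling. -/
noncomputable def bondMeasure (α : ℝ) : Measure (ℤ × ℤ) := Measure.count.withDensity (bond α)

theorem bondMeasure_apply (α : ℝ) (S : Set (ℤ × ℤ)) :
    bondMeasure α S = ∑' p, S.indicator (bond α) p := by
  rw [bondMeasure, withDensity_apply _ (MeasurableSet.of_discrete), ← lintegral_indicator
    (MeasurableSet.of_discrete), lintegral_count]

theorem coupling_nonneg (α : ℝ) (r : ℕ) : 0 ≤ coupling α r := by
  unfold coupling; split_ifs <;> positivity

theorem coupling_anti {α : ℝ} (hα : 0 ≤ α) {r s : ℕ} (hr : r ≠ 0) (h : r ≤ s) :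
    coupling α s ≤ coupling α r := by
  have hs : s ≠ 0 := by omega
  rw [coupling, coupling, if_neg hr, if_neg hs]
  exact Real.rpow_le_rpow_of_nonpos (by positivity) (by exact_mod_cast h) (by linarith)

theorem coupling_two_mul {α : ℝ} {r : ℕ} (hr : r ≠ 0) :
    coupling α (2 * r) = 2 ^ (-α) * coupling α r := by
  rw [coupling, coupling, if_neg hr, if_neg (by omega)]
  push_cast
  rw [Real.mul_rpow (by norm_num) (by positivity)]

theorem coupling_le_four_mul {α : ℝ} (hα0 : 0 ≤ α) (hα : α ≤ 2) {r s : ℕ} (hr : r ≠ 0)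
    (hs : s ≠ 0) (h : s ≤ 2 * r) : coupling α r ≤ 4 * coupling α s := by
  have h1 := coupling_anti hα0 hs h
  rw [coupling_two_mul hr] at h1
  have h2 : (1 / 4 : ℝ) ≤ 2 ^ (-α) := by
    calc (1 / 4 : ℝ) = 2 ^ (-2 : ℝ) := by
          rw [Real.rpow_neg (by norm_num)]; norm_num
      _ ≤ _ := Real.rpow_le_rpow_of_exponent_le (by norm_num) (by linarith)
  have h3 := coupling_nonneg α r
  nlinarith

theorem bond_swap (α : ℝ) (p : ℤ × ℤ) : bond α p.swap = bond α p := by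
  simp only [bond, Prod.fst_swap, Prod.snd_swap]
  rw [← Int.natAbs_neg, neg_sub]

theorem bondMeasure_preimage_swap (α : ℝ) (S : Set (ℤ × ℤ)) :
    bondMeasure α (Prod.swap ⁻¹' S) = bondMeasure α S := by
  rw [bondMeasure_apply, bondMeasure_apply, ← (Equiv.prodComm ℤ ℤ).tsum_eq]
  refine tsum_congr fun p => ?_
  simp only [Set.indicator, Equiv.coe_prodComm, Set.mem_preimage, Prod.swap_swap, bond_swap]
  rfl

/-- A set of pairs all of whose shifts by less than `W` lie in `S`, with few overlaps, is much
lighter than `S`. -/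
theorem nat_mul_bondMeasure_le {α : ℝ} (hα0 : 0 ≤ α) (hα : α ≤ 2) {S Q : Set (ℤ × ℤ)} {W N : ℕ}
    (hshift : ∀ x y, (x, y) ∈ Q → ∀ u < W, (x + (u : ℤ), y) ∈ S)
    (hne : ∀ x, (x, x) ∉ S)
    (hdist : ∀ x y, (x, y) ∈ Q → (W : ℤ) ≤ |x - y|)
    (hcount : ∀ x y (U : Finset ℕ), (∀ u ∈ U, u < W ∧ (x - (u : ℤ), y) ∈ Q) → U.card ≤ N) :
    W * bondMeasure α Q ≤ 4 * N * bondMeasure α S := by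
  classical
  simp only [bondMeasure_apply]
  calc (W : ℝ≥0∞) * ∑' p, Q.indicator (bond α) p
      = ∑ _u ∈ Finset.range W, ∑' p, Q.indicator (bond α) p := by simp
    _ ≤ ∑ u ∈ Finset.range W, ∑' p : ℤ × ℤ,
          Q.indicator (fun p => 4 * bond α (p.1 + (u : ℤ), p.2)) p := by
        refine Finset.sum_le_sum fun u hu => ENNReal.tsum_le_tsum fun p => ?_
        rw [Finset.mem_range] at hu
        by_cases hp : p ∈ Q
        · rw [Set.indicator_of_mem hp, Set.indicator_of_mem hp]
          obtain ⟨x, y⟩ := p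
          have h1 := hshift x y hp u hu
          have h2 := hdist x y hp
          have h3 : x + (u : ℤ) ≠ y := fun h => hne y (h ▸ h1)
          have h5 : (u : ℤ) < W := by exact_mod_cast hu
          have h6 : |x - y| = ((x - y).natAbs : ℤ) := (Int.natCast_natAbs _).symm
          have h4 : (4 : ℝ≥0∞) = ENNReal.ofReal 4 := by norm_num
          rw [bond, bond, h4, ← ENNReal.ofReal_mul (by norm_num)]
          refine ENNReal.ofReal_le_ofReal (coupling_le_four_mul hα0 hα ?_ ?_ ?_)
          · simp only; omega
          · simp only; omega
          · simp only; omega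
        · rw [Set.indicator_of_notMem hp]; exact zero_le
    _ = ∑ u ∈ Finset.range W, ∑' p : ℤ × ℤ,
          Q.indicator (fun _ => 4 * bond α p) (p.1 - (u : ℤ), p.2) := by
        refine Finset.sum_congr rfl fun u _ => ?_
        rw [← ((Equiv.subRight (u : ℤ)).prodCongr (Equiv.refl ℤ)).tsum_eq]
        refine tsum_congr fun p => ?_
        simp [Set.indicator]
        rfl
    _ = ∑' p : ℤ × ℤ, ∑ u ∈ Finset.range W,
          Q.indicator (fun _ => 4 * bond α p) (p.1 - (u : ℤ), p.2) := by
        rw [Summable.tsum_finsetSum fun _ _ => ENNReal.summable]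
    _ ≤ ∑' p, 4 * N * S.indicator (bond α) p := by
        refine ENNReal.tsum_le_tsum fun p => ?_
        obtain ⟨x, y⟩ := p
        simp only [Set.indicator]
        rw [← Finset.sum_filter, Finset.sum_const, nsmul_eq_mul]
        by_cases hp : (x, y) ∈ S
        · rw [if_pos hp]
          have := hcount x y ((Finset.range W).filter fun u => (x - (u : ℤ), y) ∈ Q) (by simp)
          calc _ ≤ (N : ℝ≥0∞) * (4 * bond α (x, y)) := by gcongr
            _ = _ := by ring
        · rw [Finset.filter_false_of_mem]
          · simp
          · intro u hu hQ
            have := hshift _ _ hQ u (Finset.mem_range.1 hu)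
            simp at this
            exact hp this
    _ = 4 * N * ∑' p, S.indicator (bond α) p := ENNReal.tsum_mul_left

/-! ### Tails of the coupling -/

/-- The total coupling at distances at least `2 ^ j` in one direction. -/
noncomputable def tail (α : ℝ) (j : ℕ) : ℝ≥0∞ :=
  ∑' r : ℕ, if 2 ^ j ≤ r then ENNReal.ofReal (coupling α r) else 0

/-- The total coupling at distances in `[2 ^ j, 2 ^ (j + 1))` in one direction. -/
noncomputable def block (α : ℝ) (j : ℕ) : ℝ≥0∞ :=
  ∑' r : ℕ, if 2 ^ j ≤ r ∧ r < 2 ^ (j + 1) then ENNReal.ofReal (coupling α r) else 0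

theorem coupling_eq_rpow {α : ℝ} (hα : 0 < α) (r : ℕ) : coupling α r = (r : ℝ) ^ (-α) := by
  unfold coupling
  split_ifs with h
  · subst h
    rw [Nat.cast_zero, Real.zero_rpow (by linarith)]
  · rfl

theorem tsum_coupling_ne_top {α : ℝ} (hα : 1 < α) :
    ∑' r : ℕ, ENNReal.ofReal (coupling α r) ≠ ∞ := by
  have hs : Summable fun r : ℕ => coupling α r := by
    simp_rw [coupling_eq_rpow (by linarith : 0 < α)]
    exact Real.summable_nat_rpow.2 (by linarith)
  rw [← ENNReal.ofReal_tsum_of_nonneg (coupling_nonneg α) hs]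
  exact ENNReal.ofReal_ne_top

theorem tail_ne_top {α : ℝ} (hα : 1 < α) (j : ℕ) : tail α j ≠ ∞ := by
  refine ne_top_of_le_ne_top (tsum_coupling_ne_top hα) (ENNReal.tsum_le_tsum fun r => ?_)
  split_ifs
  · exact le_rfl
  · exact zero_le

theorem tail_eq (α : ℝ) (j : ℕ) : tail α j = block α j + tail α (j + 1) := by
  rw [tail, block, tail, ← ENNReal.tsum_add]
  refine tsum_congr fun r => ?_
  have : 2 ^ j ≤ 2 ^ (j + 1) := Nat.pow_le_pow_right (by norm_num) (by omega)
  split_ifs <;> first | omega | simp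

/-- The ratio of consecutive tails. -/
noncomputable def tailRatio (α : ℝ) : ℝ≥0∞ := ENNReal.ofReal (2 ^ (1 - α))

theorem tailRatio_lt_one {α : ℝ} (hα : 1 < α) : tailRatio α < 1 := by
  rw [tailRatio, ENNReal.ofReal_lt_one]
  exact Real.rpow_lt_one_of_one_lt_of_neg (by norm_num) (by linarith)

theorem tail_succ_le {α : ℝ} (hα : 1 < α) (j : ℕ) :
    tail α (j + 1) ≤ tailRatio α * tail α j := by
  have hsplit : tail α (j + 1) =
      ∑' s : ℕ, ((if 2 ^ (j + 1) ≤ 2 * s then ENNReal.ofReal (coupling α (2 * s)) else 0) +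
        if 2 ^ (j + 1) ≤ 2 * s + 1 then ENNReal.ofReal (coupling α (2 * s + 1)) else 0) := by
    rw [ENNReal.tsum_add, tail]
    exact (tsum_even_add_odd (f := fun r : ℕ => if 2 ^ (j + 1) ≤ r then
      ENNReal.ofReal (coupling α r) else 0) ENNReal.summable ENNReal.summable).symm
  rw [hsplit, tail, ← ENNReal.tsum_mul_left]
  refine ENNReal.tsum_le_tsum fun s => ?_
  have hp : 2 ^ (j + 1) = 2 * 2 ^ j := by ring
  have hpos : 0 < 2 ^ j := by positivity
  by_cases hs : 2 ^ j ≤ s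
  · rw [if_pos (by omega), if_pos (by omega), if_pos hs]
    have h1 : coupling α (2 * s + 1) ≤ coupling α (2 * s) :=
      coupling_anti (by linarith) (by omega) (by omega)
    have h2 := coupling_two_mul (α := α) (r := s) (by omega)
    rw [tailRatio, ← ENNReal.ofReal_mul (by positivity),
      ← ENNReal.ofReal_add (coupling_nonneg _ _) (coupling_nonneg _ _)]
    apply ENNReal.ofReal_le_ofReal
    have h3 : (2 : ℝ) ^ (1 - α) = 2 * 2 ^ (-α) := by
      rw [sub_eq_add_neg, Real.rpow_add (by norm_num), Real.rpow_one]
    rw [h3]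
    nlinarith
  · rw [if_neg (by omega), if_neg (by omega), if_neg hs]
    simp

theorem tail_add_le {α : ℝ} (hα : 1 < α) (j i : ℕ) :
    tail α (j + i) ≤ tailRatio α ^ i * ((1 - tailRatio α)⁻¹ * block α j) := by
  have h0 : tail α j ≤ (1 - tailRatio α)⁻¹ * block α j := by
    have h1 := tail_succ_le hα j
    have h2 := tail_eq α j
    have h3 : tail α j - tailRatio α * tail α j ≤ block α j := by
      rw [tsub_le_iff_right]
      calc tail α j = block α j + tail α (j + 1) := h2
        _ ≤ _ := by gcongr
    have h4 : (1 - tailRatio α) * tail α j ≤ block α j := by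
      rw [ENNReal.sub_mul fun _ _ => tail_ne_top hα j, one_mul]
      exact h3
    have h5 : 1 - tailRatio α ≠ 0 := (tsub_pos_of_lt (tailRatio_lt_one hα)).ne'
    have h6 : 1 - tailRatio α ≠ ∞ := ne_top_of_le_ne_top ENNReal.one_ne_top tsub_le_self
    rw [← ENNReal.div_eq_inv_mul, ENNReal.le_div_iff_mul_le (Or.inl h5) (Or.inl h6), mul_comm]
    exact h4
  induction i with
  | zero => simpa using h0
  | succ i ih =>
    calc tail α (j + (i + 1)) ≤ tailRatio α * tail α (j + i) := tail_succ_le hα (j + i)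
      _ ≤ tailRatio α * (tailRatio α ^ i * ((1 - tailRatio α)⁻¹ * block α j)) := by gcongr
      _ = _ := by rw [pow_succ]; ring

theorem tsum_int_natAbs_le (f : ℕ → ℝ≥0∞) : ∑' z : ℤ, f z.natAbs ≤ 2 * ∑' r, f r := by
  rw [← Equiv.intEquivNatSumNat.symm.tsum_eq, Summable.tsum_sum ENNReal.summable ENNReal.summable,
    two_mul]
  refine add_le_add (ENNReal.tsum_le_tsum fun r => le_of_eq (by simp [Equiv.intEquivNatSumNat]))
    ?_
  have h : ∀ r : ℕ, (Equiv.intEquivNatSumNat.symm (Sum.inr r)).natAbs = r + 1 := by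
    intro r; simp [Equiv.intEquivNatSumNat]
  simp_rw [h]
  exact ENNReal.tsum_comp_le_tsum_of_injective (add_left_injective 1) f

/-- Pairs at distance at least `2 ^ j`, with first site in `V`. -/
theorem bondMeasure_far_le (α : ℝ) (V : Set ℤ) (j : ℕ) [DecidablePred (· ∈ V)] :
    bondMeasure α {p | p.1 ∈ V ∧ (2 : ℤ) ^ j ≤ |p.1 - p.2|} ≤
      ∑' x : ℤ, if x ∈ V then 2 * tail α j else 0 := by
  rw [bondMeasure_apply, ENNReal.tsum_prod']
  refine ENNReal.tsum_le_tsum fun x => ?_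
  split_ifs with hx
  · rw [tail]
    refine le_trans (le_of_eq ?_) (tsum_int_natAbs_le _)
    rw [← (Equiv.subLeft x).tsum_eq]
    refine tsum_congr fun z => ?_
    simp only [Set.indicator, Set.mem_ofPred_eq, Equiv.subLeft_apply, bond, hx, true_and,
      sub_sub_cancel]
    have : (2 : ℤ) ^ j ≤ |z| ↔ 2 ^ j ≤ z.natAbs := by
      rw [← Int.natCast_natAbs]
      exact_mod_cast Iff.rfl
    simp only [this]
  · simp [Set.indicator, hx]

theorem tsum_block_le (α : ℝ) (V : Set ℤ) (j : ℕ) [DecidablePred (· ∈ V)]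
    (hV : ∀ x ∈ V, ∀ r : ℕ, 2 ^ j ≤ r → x - (r : ℤ) ∉ V) :
    (∑' x : ℤ, if x ∈ V then block α j else 0) ≤ bondMeasure α (cut V) := by
  rw [bondMeasure_apply, ENNReal.tsum_prod']
  refine ENNReal.tsum_le_tsum fun x => ?_
  split_ifs with hx
  · have hinj : Function.Injective fun r : ℕ => x - (r : ℤ) := by
      intro a b h; simp only at h; omega
    refine le_trans ?_ (ENNReal.tsum_comp_le_tsum_of_injective hinj _)
    rw [block]
    refine ENNReal.tsum_le_tsum fun r => ?_
    split_ifs with hr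
    · rw [Set.indicator_of_mem]
      · simp [bond]
      · have := hV x hx r hr.1
        simp [cut, hx, this]
    · exact zero_le
  · exact zero_le

theorem bondMeasure_far_le_cut {α : ℝ} (hα : 1 < α) {V : Set ℤ} {j i : ℕ}
    (hV : ∀ x ∈ V, ∀ r : ℕ, 2 ^ j ≤ r → x - (r : ℤ) ∉ V) :
    bondMeasure α {p | p.1 ∈ V ∧ (2 : ℤ) ^ (j + i) ≤ |p.1 - p.2|} ≤
      2 * tailRatio α ^ i * (1 - tailRatio α)⁻¹ * bondMeasure α (cut V) := by
  classical
  refine (bondMeasure_far_le α V (j + i)).trans ?_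
  refine le_trans ?_ (mul_le_mul_right (tsum_block_le α V j hV) _)
  rw [← ENNReal.tsum_mul_left]
  refine ENNReal.tsum_le_tsum fun x => ?_
  split_ifs
  · calc 2 * tail α (j + i) ≤ 2 * (tailRatio α ^ i * ((1 - tailRatio α)⁻¹ * block α j)) := by
          gcongr; exact tail_add_le hα j i
      _ = _ := by ring
  · exact zero_le

/-! ### Isolated clusters interact weakly with the rest -/

theorem mem_cut_vol_iff_min_max (γ : Finset ℤ) (x y : ℤ) :
    (x, y) ∈ cut (vol γ) ↔ Odd (γ.filter fun r => min x y ≤ r ∧ r < max x y).card := by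
  rcases le_total x y with h | h
  · rw [min_eq_left h, max_eq_right h, mem_cut_vol_iff γ h]
  · rw [min_eq_right h, max_eq_left h, ← swap_mem_cut, mem_cut_vol_iff γ h]

theorem exists_mem_between_of_mem_vol {C : Finset ℤ} (hC : Even C.card) {x : ℤ}
    (hx : x ∈ vol C) : ∃ c ∈ C, ∃ d ∈ C, c < x ∧ x ≤ d := by
  obtain ⟨c, hc, hcx⟩ := exists_lt_of_mem_vol hx
  obtain ⟨d, hd, hdx⟩ := exists_ge_of_mem_vol hC hx
  exact ⟨c, hc, d, hd, hcx, hdx⟩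

theorem le_dist_of_between {C : Finset ℤ} (hC : Even C.card) {l D : ℤ} (hlD : l < D)
    (hdiam : ∀ p ∈ C, ∀ q ∈ C, |p - q| ≤ l) {x y r : ℤ} (hx : x ∈ vol C)
    (hr : ∀ p ∈ C, D ≤ |p - r|) (hb : (x ≤ r ∧ r < y) ∨ (y ≤ r ∧ r < x)) : D ≤ |x - y| := by
  obtain ⟨c, hc, d, hd, hcx, hxd⟩ := exists_mem_between_of_mem_vol hC hx
  have h1 := hdiam c hc d hd
  have h2 := hr c hc
  have h3 := hr d hd
  rw [abs_le] at h1
  rw [le_abs] at h2 h3 ⊢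
  omega

theorem reach_eq_four_mul {k : ℕ} (hk : 2 ≤ k) (m : ℕ) :
    reach k m = 4 * ((2 ^ (m + m / 4 + (k - 2)) : ℕ) : ℤ) := by
  rw [reach]
  push_cast
  rw [show m + m / 4 + k = (m + m / 4 + (k - 2)) + 2 by omega, pow_add]
  ring

theorem sixteen_mul_le_reach {k : ℕ} (hk : 4 ≤ k) (m : ℕ) : 16 * (2 : ℤ) ^ m ≤ reach k m := by
  have h1 := two_pow_mul_le_reach k m
  have h2 : (2 : ℤ) ^ 4 ≤ 2 ^ k := pow_le_pow_right₀ (by norm_num) hk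
  have h3 : (0 : ℤ) < 2 ^ m := by positivity
  nlinarith

theorem IsCluster.disjoint_of_lt {k : ℕ} {B γ C : Finset ℤ} {m n : ℕ} (hmn : m < n)
    (hγ : γ ⊆ peel k B n) (hC : IsCluster k m (peel k B m) C) {r : ℤ} (hr : r ∈ γ) :
    ∀ p ∈ C, reach k m ≤ |p - r| := by
  intro p hp
  refine hC.sep p hp r (peel_antitone k B hmn.le (hγ hr)) fun hrC => ?_
  exact hC.disjoint_peel_succ hrC (peel_antitone k B hmn (hγ hr))

theorem card_le_of_forall_lt {U : Finset ℕ} {N : ℕ}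
    (h : ∀ a ∈ U, ∀ b ∈ U, a < b + N) : U.card ≤ N := by
  rcases U.eq_empty_or_nonempty with rfl | hU
  · simp
  · have : U ⊆ Finset.Ico (U.min' hU) (U.min' hU + N) := by
      intro a ha
      rw [Finset.mem_Ico]
      exact ⟨Finset.min'_le _ _ ha, h a ha _ (Finset.min'_mem _ _)⟩
    simpa using Finset.card_le_card this

/-- The pairs cut by `vol γ` with one site enclosed by a cluster peeled at scale `m`. -/
def clusterPairs (k : ℕ) (B γ : Finset ℤ) (m : ℕ) : Set (ℤ × ℤ) :=
  {p | (∃ C, IsCluster k m (peel k B m) C ∧ p.1 ∈ vol C) ∧ p ∈ cut (vol γ) ∧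
    reach k m ≤ |p.1 - p.2|}

theorem bondMeasure_clusterPairs_le {α : ℝ} (hα0 : 0 ≤ α) (hα : α ≤ 2) {k : ℕ} (hk : 4 ≤ k)
    {B γ : Finset ℤ} {m n : ℕ} (hmn : m < n) (hγ : γ ⊆ peel k B n) :
    bondMeasure α (clusterPairs k B γ m) ≤
      16 * 2⁻¹ ^ k * 2⁻¹ ^ (m / 4) * bondMeasure α (cut (vol γ)) := by
  have hD := reach_eq_four_mul (by omega : 2 ≤ k) m
  have h16 := sixteen_mul_le_reach hk m
  have h2m : (0 : ℤ) < 2 ^ m := by positivity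
  set W : ℕ := 2 ^ (m + m / 4 + (k - 2)) with hW
  have key : (W : ℝ≥0∞) * bondMeasure α (clusterPairs k B γ m) ≤
      4 * (2 ^ m : ℕ) * bondMeasure α (cut (vol γ)) := by
    refine nat_mul_bondMeasure_le hα0 hα ?_ ?_ ?_ ?_
    · rintro x y ⟨⟨C, hC, hx⟩, hcut, hdist⟩ u hu
      have : x ∈ vol γ ↔ x + (u : ℤ) ∈ vol γ := by
        refine mem_vol_iff_of_no_between fun r hr hb => ?_
        have := le_dist_of_between hC.even (by linarith) hC.diam hx (hC.disjoint_of_lt hmn hγ hr)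
          hb
        have hu' : (u : ℤ) < W := by exact_mod_cast hu
        rw [sub_add_cancel_left, abs_neg, abs_of_nonneg (by positivity)] at this
        omega
      simp only [cut, Set.mem_ofPred_eq] at hcut ⊢
      rwa [← this]
    · intro x hx
      exact hx Iff.rfl
    · rintro x y ⟨_, _, hdist⟩
      have : (0 : ℤ) ≤ W := by positivity
      simp only at hdist
      omega
    · intro x y U hU
      refine card_le_of_forall_lt fun a ha b hb => ?_
      obtain ⟨haW, ⟨C, hC, hxa⟩, -⟩ := hU a ha
      obtain ⟨hbW, ⟨C', hC', hxb⟩, -⟩ := hU b hb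
      simp only at hxa hxb
      obtain ⟨c, hc, d, hd, hcx, hxd⟩ := exists_mem_between_of_mem_vol hC.even hxa
      obtain ⟨c', hc', d', hd', hcx', hxd'⟩ := exists_mem_between_of_mem_vol hC'.even hxb
      have h1 := hC.diam c hc d hd
      have h2 := hC'.diam c' hc' d' hd'
      have haW' : (a : ℤ) < W := by exact_mod_cast haW
      have hbW' : (b : ℤ) < W := by exact_mod_cast hbW
      have hcc : c' ∈ C := by
        by_contra hn
        have := hC.sep c hc c' (hC'.subset hc') hn
        grind
      obtain rfl := hC.eq_of_mem (by omega) hC' hcc hc'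
      have h3 := hC.diam c hc d' hd'
      have h4 := hC.diam c' hc' d hd
      have : (a : ℤ) < b + (2 ^ m : ℕ) := by push_cast; grind
      exact_mod_cast this
  have hW0 : (W : ℝ≥0∞) ≠ 0 := by simp [hW]
  have hWt : (W : ℝ≥0∞) ≠ ∞ := ENNReal.natCast_ne_top W
  rw [mul_comm, ← ENNReal.le_div_iff_mul_le (Or.inl hW0) (Or.inl hWt)] at key
  refine key.trans (le_of_eq ?_)
  rw [ENNReal.div_eq_inv_mul, ← mul_assoc]
  congr 1
  rw [hW]
  push_cast
  rw [show m + m / 4 + (k - 2) = m + (m / 4 + (k - 2)) by omega, pow_add,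
    ENNReal.mul_inv (by simp) (by simp)]
  have h4 : (2⁻¹ : ℝ≥0∞) ^ k = 4⁻¹ * 2⁻¹ ^ (k - 2) := by
    conv_lhs => rw [show k = 2 + (k - 2) by omega, pow_add]
    congr 1
    rw [← ENNReal.inv_pow]
    norm_num
  have h5 : (16 : ℝ≥0∞) * 4⁻¹ = 4 := by
    rw [show (16 : ℝ≥0∞) = 4 * 4 by norm_num, mul_assoc, ENNReal.mul_inv_cancel (by norm_num)
      (by norm_num), mul_one]
  have h6 : ((2 : ℝ≥0∞) ^ m)⁻¹ * 2 ^ m = 1 := ENNReal.inv_mul_cancel (by simp) (by simp)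
  rw [h4, pow_add, ENNReal.mul_inv (by simp) (by simp), ENNReal.inv_pow, ENNReal.inv_pow]
  calc ((2 : ℝ≥0∞)⁻¹ ^ m) * (2⁻¹ ^ (m / 4) * (2 ^ (k - 2))⁻¹) * (4 * 2 ^ m)
      = (((2 : ℝ≥0∞) ^ m)⁻¹ * 2 ^ m) * 4 * (2⁻¹ ^ (m / 4) * (2⁻¹ ^ (k - 2))) := by
        rw [ENNReal.inv_pow, ENNReal.inv_pow]; ring
    _ = (16 * 4⁻¹) * (2⁻¹ ^ (m / 4) * (2⁻¹ ^ (k - 2))) := by rw [h6, h5, one_mul]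
    _ = _ := by ring

theorem sum_inv_two_pow_div_four_le (n : ℕ) :
    ∑ m ∈ Finset.range n, (2⁻¹ : ℝ≥0∞) ^ (m / 4) ≤ 8 := by
  have h4 : ∀ j : ℕ, ∑ m ∈ Finset.range (4 * j), (2⁻¹ : ℝ≥0∞) ^ (m / 4) =
      4 * ∑ i ∈ Finset.range j, 2⁻¹ ^ i := by
    intro j
    induction j with
    | zero => simp
    | succ j ih =>
      rw [show 4 * (j + 1) = 4 * j + 1 + 1 + 1 + 1 by ring, Finset.sum_range_succ,
        Finset.sum_range_succ, Finset.sum_range_succ, Finset.sum_range_succ, ih,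
        Finset.sum_range_succ, show (4 * j) / 4 = j by omega, show (4 * j + 1) / 4 = j by omega,
        show (4 * j + 1 + 1) / 4 = j by omega, show (4 * j + 1 + 1 + 1) / 4 = j by omega]
      ring
  calc ∑ m ∈ Finset.range n, (2⁻¹ : ℝ≥0∞) ^ (m / 4)
      ≤ ∑ m ∈ Finset.range (4 * n), (2⁻¹ : ℝ≥0∞) ^ (m / 4) :=
        Finset.sum_le_sum_of_subset (Finset.range_mono (by omega))
    _ = 4 * ∑ i ∈ Finset.range n, 2⁻¹ ^ i := h4 n
    _ ≤ 4 * ∑' i : ℕ, 2⁻¹ ^ i := by gcongr; exact ENNReal.sum_le_tsum _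
    _ = 8 := by
      rw [ENNReal.tsum_geometric, ENNReal.one_sub_inv_two, inv_inv]
      norm_num

/-- The proportion of the energy of a peeled cluster that the rest can screen. -/
noncomputable def screening (α : ℝ) (k : ℕ) : ℝ≥0∞ :=
  256 * 2⁻¹ ^ k + 4 * (tailRatio α ^ (k - 1) * (1 - tailRatio α)⁻¹)

theorem bondMeasure_cut_sdiff_le {α : ℝ} (hα1 : 1 < α) (hα2 : α ≤ 2) {k : ℕ} (hk : 4 ≤ k)
    {B γ : Finset ℤ} {n : ℕ} (h : IsCluster k n (peel k B n) γ) :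
    bondMeasure α (cut (vol γ) \ cut (vol B)) ≤
      screening α k * bondMeasure α (cut (vol γ)) := by
  have hα0 : 0 ≤ α := by linarith
  set far : Set (ℤ × ℤ) := {p | p.1 ∈ vol γ ∧ (2 : ℤ) ^ ((n + 1) + (k - 1)) ≤ |p.1 - p.2|}
  set near : Set (ℤ × ℤ) := ⋃ m ∈ Finset.range n, clusterPairs k B γ m
  have hsub : cut (vol γ) \ cut (vol B) ⊆
      (near ∪ Prod.swap ⁻¹' near) ∪ (far ∪ Prod.swap ⁻¹' far) := by
    rintro ⟨x, y⟩ ⟨hγ, hB⟩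
    have hγ' := (mem_cut_vol_iff_min_max γ x y).1 hγ
    rw [mem_cut_vol_iff_min_max, Nat.not_odd_iff_even] at hB
    have hodd : Odd ((B \ γ).filter fun r => min x y ≤ r ∧ r < max x y).card := by
      have hs : (B.filter fun r => min x y ≤ r ∧ r < max x y).card =
          ((B \ γ).filter fun r => min x y ≤ r ∧ r < max x y).card +
            (γ.filter fun r => min x y ≤ r ∧ r < max x y).card := by
        rw [← Finset.card_union_of_disjoint, ← Finset.filter_union, Finset.sdiff_union_of_subset]
        · exact h.subset.trans (peel_antitone k B (Nat.zero_le n))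
        · exact Finset.disjoint_filter_filter Finset.sdiff_disjoint
      rw [hs, Nat.even_add'] at hB
      exact hB.2 hγ'
    rcases odd_filter_sdiff (by omega) h.subset _ hodd with ⟨m, hm, C, hC, hCodd⟩ | hrest
    · left
      rw [← mem_cut_vol_iff_min_max] at hCodd
      have h16 := sixteen_mul_le_reach hk m
      have h2m : (0 : ℤ) < 2 ^ m := by positivity
      by_cases hx : x ∈ vol C
      · left
        refine Set.mem_biUnion (Finset.mem_range.2 hm) ⟨⟨C, hC, hx⟩, hγ, ?_⟩
        obtain ⟨r, hr, hb⟩ := exists_between_of_mem_cut_vol hγ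
        exact le_dist_of_between hC.even (by linarith) hC.diam hx
          (hC.disjoint_of_lt hm h.subset hr) hb
      · right
        have hy : y ∈ vol C := by
          simp only [cut, Set.mem_ofPred_eq] at hCodd; tauto
        have hγs := swap_mem_cut.2 hγ
        refine Set.mem_biUnion (Finset.mem_range.2 hm) ⟨⟨C, hC, hy⟩, hγs, ?_⟩
        obtain ⟨r, hr, hb⟩ := exists_between_of_mem_cut_vol hγs
        exact le_dist_of_between hC.even (by linarith) hC.diam hy
          (hC.disjoint_of_lt hm h.subset hr) hb
    · right
      rw [← mem_cut_vol_iff_min_max] at hrest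
      have h16 := sixteen_mul_le_reach hk n
      have h2n : (0 : ℤ) < 2 ^ n := by positivity
      have hfar : (2 : ℤ) ^ ((n + 1) + (k - 1)) ≤ reach k n := by
        rw [show (n + 1) + (k - 1) = n + k by omega, pow_add]
        exact two_pow_mul_le_reach k n
      have hsep : ∀ r ∈ peel k B n \ γ, ∀ p ∈ γ, reach k n ≤ |p - r| := fun r hr p hp =>
        h.sep p hp r (Finset.mem_sdiff.1 hr).1 (Finset.mem_sdiff.1 hr).2
      by_cases hx : x ∈ vol γ
      · left
        refine ⟨hx, hfar.trans ?_⟩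
        obtain ⟨r, hr, hb⟩ := exists_between_of_mem_cut_vol hrest
        exact le_dist_of_between h.even (by linarith) h.diam hx (hsep r hr) hb
      · right
        have hy : y ∈ vol γ := by
          simp only [cut, Set.mem_ofPred_eq] at hγ; tauto
        refine ⟨hy, hfar.trans ?_⟩
        obtain ⟨r, hr, hb⟩ := exists_between_of_mem_cut_vol (swap_mem_cut.2 hrest)
        exact le_dist_of_between h.even (by linarith) h.diam hy (hsep r hr) hb
  have hnear : bondMeasure α near ≤ 128 * 2⁻¹ ^ k * bondMeasure α (cut (vol γ)) := by
    calc bondMeasure α near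
        ≤ ∑ m ∈ Finset.range n, bondMeasure α (clusterPairs k B γ m) :=
          measure_biUnion_finset_le _ _
      _ ≤ ∑ m ∈ Finset.range n,
            16 * 2⁻¹ ^ k * 2⁻¹ ^ (m / 4) * bondMeasure α (cut (vol γ)) :=
          Finset.sum_le_sum fun m hm =>
            bondMeasure_clusterPairs_le hα0 hα2 hk (Finset.mem_range.1 hm) h.subset
      _ = 16 * 2⁻¹ ^ k * (∑ m ∈ Finset.range n, 2⁻¹ ^ (m / 4)) *
            bondMeasure α (cut (vol γ)) := by
          rw [Finset.mul_sum, Finset.sum_mul]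
      _ ≤ 16 * 2⁻¹ ^ k * 8 * bondMeasure α (cut (vol γ)) := by
          gcongr; exact sum_inv_two_pow_div_four_le n
      _ = _ := by ring
  have hfar : bondMeasure α far ≤
      2 * tailRatio α ^ (k - 1) * (1 - tailRatio α)⁻¹ * bondMeasure α (cut (vol γ)) := by
    refine bondMeasure_far_le_cut hα1 fun x hx r hr => ?_
    obtain ⟨c, hc, d, hd, hcx, hxd⟩ := exists_mem_between_of_mem_vol h.even hx
    refine notMem_vol_of_forall_ge fun p hp => ?_
    have h1 := h.diam p hp d hd
    have h2 : (2 : ℤ) ^ (n + 1) ≤ r := by exact_mod_cast hr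
    have h3 : (0 : ℤ) < 2 ^ n := by positivity
    rw [pow_succ] at h2
    grind
  calc bondMeasure α (cut (vol γ) \ cut (vol B))
      ≤ bondMeasure α ((near ∪ Prod.swap ⁻¹' near) ∪ (far ∪ Prod.swap ⁻¹' far)) :=
        measure_mono hsub
    _ ≤ (bondMeasure α near + bondMeasure α near) + (bondMeasure α far + bondMeasure α far) := by
        refine (measure_union_le _ _).trans (add_le_add ?_ ?_)
        · refine (measure_union_le _ _).trans ?_
          rw [bondMeasure_preimage_swap]
        · refine (measure_union_le _ _).trans ?_
          rw [bondMeasure_preimage_swap]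
    _ ≤ _ := by
        refine (add_le_add (add_le_add hnear hnear) (add_le_add hfar hfar)).trans (le_of_eq ?_)
        rw [screening]
        ring

theorem exists_screening_le {α : ℝ} (hα : 1 < α) {ε : ℝ≥0∞} (hε : 0 < ε) :
    ∃ k, 4 ≤ k ∧ screening α k ≤ ε := by
  have h1 : Filter.Tendsto (fun k : ℕ => screening α k) Filter.atTop (nhds 0) := by
    have ha : Filter.Tendsto (fun k : ℕ => (256 : ℝ≥0∞) * 2⁻¹ ^ k) Filter.atTop (nhds 0) := by
      have := ENNReal.Tendsto.const_mul (a := (256 : ℝ≥0∞))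
        (ENNReal.tendsto_pow_atTop_nhds_zero_of_lt_one ENNReal.one_half_lt_one)
        (Or.inr (by norm_num))
      simpa using this
    have hb : Filter.Tendsto
        (fun k : ℕ => (4 : ℝ≥0∞) * (tailRatio α ^ (k - 1) * (1 - tailRatio α)⁻¹))
        Filter.atTop (nhds 0) := by
      have h0 : Filter.Tendsto (fun k : ℕ => tailRatio α ^ (k - 1)) Filter.atTop (nhds 0) :=
        (ENNReal.tendsto_pow_atTop_nhds_zero_of_lt_one (tailRatio_lt_one hα)).comp
          (Filter.tendsto_sub_atTop_nat 1)
      have hc : (1 - tailRatio α)⁻¹ ≠ ∞ := by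
        exact ENNReal.inv_ne_top.2 (tsub_pos_of_lt (tailRatio_lt_one hα)).ne'
      have := ENNReal.Tendsto.const_mul (a := (4 : ℝ≥0∞))
        (ENNReal.Tendsto.mul_const h0 (Or.inr hc)) (Or.inr (by norm_num))
      simpa using this
    simpa [screening] using ha.add hb
  have h2 := (h1.eventually_lt_const hε).and (Filter.eventually_ge_atTop 4)
  obtain ⟨k, hk, hk4⟩ := h2.exists
  exact ⟨k, hk4, hk.le⟩

/-! ### Separated nets -/

/-- Distinct points of `S` are at distance more than `2 ^ m`. -/
def IsSpread (m : ℕ) (S : Finset ℤ) : Prop := ∀ p ∈ S, ∀ q ∈ S, p ≠ q → 2 ^ m < |p - q|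

theorem exists_max_spread (m : ℕ) (γ : Finset ℤ) :
    ∃ S ⊆ γ, IsSpread m S ∧ ∀ S' ⊆ γ, IsSpread m S' → S'.card ≤ S.card := by
  classical
  obtain ⟨S, hS, hmax⟩ := Finset.exists_max_image (γ.powerset.filter (IsSpread m)) Finset.card
    ⟨∅, by simp [IsSpread]⟩
  simp only [Finset.mem_filter, Finset.mem_powerset] at hS hmax
  exact ⟨S, hS.1, hS.2, fun S' h h' => hmax S' ⟨h, h'⟩⟩

/-- A separated subset of `γ` of maximal cardinality, at scale `m`. -/
noncomputable def net (m : ℕ) (γ : Finset ℤ) : Finset ℤ := (exists_max_spread m γ).choose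

theorem net_subset (m : ℕ) (γ : Finset ℤ) : net m γ ⊆ γ := (exists_max_spread m γ).choose_spec.1

theorem isSpread_net (m : ℕ) (γ : Finset ℤ) : IsSpread m (net m γ) :=
  (exists_max_spread m γ).choose_spec.2.1

theorem IsSpread.card_le {m : ℕ} {γ S : Finset ℤ} (h : IsSpread m S) (hS : S ⊆ γ) :
    S.card ≤ (net m γ).card := (exists_max_spread m γ).choose_spec.2.2 S hS h

theorem exists_net_near {m : ℕ} {γ : Finset ℤ} {q : ℤ} (hq : q ∈ γ) :
    ∃ s ∈ net m γ, |s - q| ≤ 2 ^ m := by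
  by_contra! hc
  have hqn : q ∉ net m γ := fun h => by
    have h1 := hc q h
    have h2 : (0 : ℤ) < 2 ^ m := by positivity
    rw [sub_self, abs_zero] at h1
    omega
  have hs : IsSpread m (insert q (net m γ)) := by
    intro a ha b hb hab
    rw [Finset.mem_insert] at ha hb
    rcases ha with rfl | ha <;> rcases hb with rfl | hb
    · exact absurd rfl hab
    · rw [abs_sub_comm]; exact hc b hb
    · exact hc a ha
    · exact isSpread_net m γ a ha b hb hab
  have := hs.card_le (Finset.insert_subset hq (net_subset m γ))
  rw [Finset.card_insert_of_notMem hqn] at this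
  omega

theorem card_net_anti (γ : Finset ℤ) {m m' : ℕ} (h : m ≤ m') :
    (net m' γ).card ≤ (net m γ).card := by
  refine IsSpread.card_le (fun p hp q hq hpq => ?_) (net_subset m' γ)
  have h1 := isSpread_net m' γ p hp q hq hpq
  have h2 : (2 : ℤ) ^ m ≤ 2 ^ m' := pow_le_pow_right₀ (by norm_num) h
  omega

/-- The points of the net at scale `m` that have no points of `γ` at intermediate distances. -/
noncomputable def isolated (k m : ℕ) (γ : Finset ℤ) : Finset ℤ :=
  open Classical in
  (net m γ).filter fun p =>
    ∀ q ∈ γ, |q - p| ≤ 2 ^ (m + 1) ∨ reach k (m + 2) + 2 ^ (m + 1) ≤ |q - p|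

theorem two_mul_card_net_le (k : ℕ) (γ : Finset ℤ) {m m' : ℕ} (h : m + m / 4 + (k + 6) ≤ m') :
    2 * (net m' γ).card ≤ (net m γ).card + (isolated k m γ).card := by
  classical
  have hQ : (2 : ℤ) ^ m ≤ 2 ^ (m + m / 4 + k) := pow_le_pow_right₀ (by norm_num) (by omega)
  have hR : reach k (m + 2) ≤ 8 * 2 ^ (m + m / 4 + k) := by
    rw [reach, show (8 : ℤ) = 2 ^ 3 by norm_num, ← pow_add]
    exact pow_le_pow_right₀ (by norm_num) (by omega)
  have hm' : 64 * (2 : ℤ) ^ (m + m / 4 + k) ≤ 2 ^ m' := by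
    rw [show (64 : ℤ) = 2 ^ 6 by norm_num, ← pow_add]
    exact pow_le_pow_right₀ (by norm_num) (by omega)
  have hQ0 : (0 : ℤ) < 2 ^ m := by positivity
  have hm1 : (2 : ℤ) ^ (m + 1) = 2 * 2 ^ m := by ring
  set Q : ℤ := 2 ^ (m + m / 4 + k)
  have hf : ∀ s : ℤ, ∃ t, s ∈ net m' γ → t ∈ net m γ ∧ |t - s| ≤ 2 ^ m := by
    intro s
    by_cases hs : s ∈ net m' γ
    · obtain ⟨t, ht, hts⟩ := exists_net_near (m := m) (net_subset m' γ hs)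
      exact ⟨t, fun _ => ⟨ht, hts⟩⟩
    · exact ⟨0, fun h => absurd h hs⟩
  choose f hf using hf
  have hg : ∀ s : ℤ, ∃ t, s ∈ net m' γ → f s ∉ isolated k m γ →
      t ∈ net m γ ∧ t ≠ f s ∧ |t - f s| ≤ 11 * Q := by
    intro s
    by_cases hs : s ∈ net m' γ ∧ f s ∉ isolated k m γ
    · obtain ⟨hs1, hs2⟩ := hs
      simp only [isolated, Finset.mem_filter, not_and, not_forall, not_or, not_le] at hs2
      obtain ⟨q, hq, hq1, hq2⟩ := hs2 (hf s hs1).1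
      obtain ⟨t, ht, htq⟩ := exists_net_near (m := m) hq
      refine ⟨t, fun _ _ => ⟨ht, ?_, ?_⟩⟩
      · rintro rfl
        rw [abs_sub_comm] at htq
        omega
      · have : |t - f s| ≤ |t - q| + |q - f s| := abs_sub_le _ _ _
        omega
    · exact ⟨0, fun h1 h2 => absurd ⟨h1, h2⟩ hs⟩
  choose g hg using hg
  have hsep : ∀ s ∈ net m' γ, ∀ t ∈ net m' γ, |s - t| ≤ 24 * Q → s = t := by
    intro s hs t ht hst
    by_contra hne
    have := isSpread_net m' γ s hs t ht hne
    omega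
  have hfinj : Set.InjOn f (net m' γ : Set ℤ) := by
    intro s hs t ht hst
    have h1 := (hf s hs).2
    have h2 := (hf t ht).2
    refine hsep s hs t ht ?_
    rw [hst] at h1
    rw [abs_le] at *
    omega
  set bad := (net m' γ).filter fun s => f s ∉ isolated k m γ with hbad
  have hbadmem : ∀ s ∈ bad, s ∈ net m' γ ∧ f s ∉ isolated k m γ := fun s hs =>
    Finset.mem_filter.1 hs
  have hginj : Set.InjOn g (bad : Set ℤ) := by
    intro s hs t ht hst
    obtain ⟨hs1, hs2⟩ := hbadmem s hs
    obtain ⟨ht1, ht2⟩ := hbadmem t ht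
    have h1 := (hf s hs1).2
    have h2 := (hf t ht1).2
    have h3 := (hg s hs1 hs2).2.2
    have h4 := (hg t ht1 ht2).2.2
    refine hsep s hs1 t ht1 ?_
    rw [hst] at h3
    rw [abs_le] at *
    omega
  have hdisj : Disjoint ((net m' γ).image f) (bad.image g) := by
    rw [Finset.disjoint_left]
    intro x hx hx'
    rw [Finset.mem_image] at hx hx'
    obtain ⟨s, hs, rfl⟩ := hx
    obtain ⟨t, ht, hts⟩ := hx'
    obtain ⟨ht1, ht2⟩ := hbadmem t ht
    have h1 := (hf s hs).2
    have h2 := (hf t ht1).2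
    have h3 := hg t ht1 ht2
    have : s = t := by
      refine hsep s hs t ht1 ?_
      have h4 := h3.2.2
      rw [hts] at h4
      rw [abs_le] at *
      omega
    subst this
    exact h3.2.1 hts
  have hcard : (net m' γ).card + bad.card ≤ (net m γ).card := by
    rw [← Finset.card_image_of_injOn hfinj, ← Finset.card_image_of_injOn hginj,
      ← Finset.card_union_of_disjoint hdisj]
    refine Finset.card_le_card (Finset.union_subset ?_ ?_)
    · intro x hx
      rw [Finset.mem_image] at hx
      obtain ⟨s, hs, rfl⟩ := hx
      exact (hf s hs).1
    · intro x hx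
      rw [Finset.mem_image] at hx
      obtain ⟨s, hs, rfl⟩ := hx
      exact (hg s (hbadmem s hs).1 (hbadmem s hs).2).1
  have hgood : ((net m' γ).filter fun s => f s ∈ isolated k m γ).card ≤
      (isolated k m γ).card := by
    refine Finset.card_le_card_of_injOn f (fun s hs => (Finset.mem_filter.1 hs).2) ?_
    exact hfinj.mono (by intro s hs; exact (Finset.mem_filter.1 hs).1)
  have hsum : ((net m' γ).filter fun s => f s ∈ isolated k m γ).card + bad.card =
      (net m' γ).card := by
    rw [hbad]
    convert! Finset.card_filter_add_card_filter_not (s := net m' γ)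
      (fun s => f s ∈ isolated k m γ)
  omega

/-! ### Summing a sequence that contracts along slowly dilated indices -/

theorem eight_mul_sum_le {a g : ℕ → ℕ} {K : ℕ} (ha : Antitone a)
    (h : ∀ m m', m + m / 4 + K ≤ m' → 2 * a m' ≤ a m + g m) (J : ℕ) :
    8 * ∑ i ∈ Finset.range (5 * J), a (K + i) ≤
      5 * ∑ i ∈ Finset.range (4 * J), a i + 8 * ∑ i ∈ Finset.range (4 * J), g i := by
  induction J with
  | zero => simp
  | succ J ih =>
    rw [show 5 * (J + 1) = 5 * J + 1 + 1 + 1 + 1 + 1 by ring,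
      show 4 * (J + 1) = 4 * J + 1 + 1 + 1 + 1 by ring]
    simp only [Finset.sum_range_succ]
    have h0 := h (4 * J) (K + 5 * J) (by omega)
    have h1 := h (4 * J + 1) (K + (5 * J + 1)) (by omega)
    have h2 := h (4 * J + 2) (K + (5 * J + 2)) (by omega)
    have h3 := h (4 * J + 3) (K + (5 * J + 3)) (by omega)
    have h4 := h (4 * J + 3) (K + (5 * J + 4)) (by omega)
    have d0 : a (4 * J + 3) ≤ a (4 * J) := ha (by omega)
    have d1 : a (4 * J + 3) ≤ a (4 * J + 1) := ha (by omega)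
    have d2 : a (4 * J + 3) ≤ a (4 * J + 2) := ha (by omega)
    omega

theorem sum_le_of_contracting {a g : ℕ → ℕ} {K n : ℕ} (ha : Antitone a)
    (h : ∀ m m', m + m / 4 + K ≤ m' → m' ≤ n → 2 * a m' ≤ a m + g m) (hK : 6 ≤ K) :
    ∑ i ∈ Finset.range (n + 1), a i ≤ 3 * (K * a 0 + ∑ i ∈ Finset.range (n - 2), g i) := by
  set a' : ℕ → ℕ := fun m => if m ≤ n then a m else 0 with ha'
  set g' : ℕ → ℕ := fun m => if m < n - 2 then g m else 0 with hg'
  have hanti : Antitone a' := by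
    intro i j hij
    simp only [ha']
    split_ifs
    · exact ha hij
    · omega
    · omega
    · exact le_rfl
  have hstep : ∀ m m', m + m / 4 + K ≤ m' → 2 * a' m' ≤ a' m + g' m := by
    intro m m' hmm
    simp only [ha', hg']
    by_cases hm' : m' ≤ n
    · rw [if_pos hm', if_pos (by omega), if_pos (by omega)]
      exact h m m' hmm hm'
    · rw [if_neg hm']; omega
  have hmain := eight_mul_sum_le hanti hstep (n + 1)
  have hsa : ∑ i ∈ Finset.range (n + 1), a i = ∑ i ∈ Finset.range (n + 1), a' i :=
    Finset.sum_congr rfl fun i hi => by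
      rw [Finset.mem_range] at hi
      simp only [ha']
      rw [if_pos (by omega)]
  have hsa4 : ∑ i ∈ Finset.range (4 * (n + 1)), a' i = ∑ i ∈ Finset.range (n + 1), a' i := by
    symm
    refine Finset.sum_subset (Finset.range_mono (by omega)) fun i _ hi => ?_
    rw [Finset.mem_range] at hi
    simp only [ha']
    rw [if_neg (by omega)]
  have hsg4 : ∑ i ∈ Finset.range (4 * (n + 1)), g' i = ∑ i ∈ Finset.range (n - 2), g i := by
    calc _ = ∑ i ∈ Finset.range (n - 2), g' i := by
          symm
          refine Finset.sum_subset (Finset.range_mono (by omega)) fun i _ hi => ?_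
          rw [Finset.mem_range] at hi
          simp only [hg']
          rw [if_neg hi]
      _ = _ := Finset.sum_congr rfl fun i hi => by
          simp only [hg']
          rw [if_pos (Finset.mem_range.1 hi)]
  have hhead : ∑ i ∈ Finset.range (n + 1), a' i ≤
      K * a 0 + ∑ i ∈ Finset.range (5 * (n + 1)), a' (K + i) := by
    calc _ ≤ ∑ i ∈ Finset.range (K + 5 * (n + 1)), a' i :=
          Finset.sum_le_sum_of_subset (Finset.range_mono (by omega))
      _ = ∑ i ∈ Finset.range K, a' i + ∑ i ∈ Finset.range (5 * (n + 1)), a' (K + i) :=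
          Finset.sum_range_add _ _ _
      _ ≤ _ := by
          gcongr
          calc _ ≤ ∑ _i ∈ Finset.range K, a 0 := Finset.sum_le_sum fun i _ => by
                simp only [ha']
                split_ifs
                · exact ha (Nat.zero_le i)
                · exact Nat.zero_le _
            _ = _ := by simp
  rw [hsa4, hsg4] at hmain
  rw [hsa]
  omega

/-! ### The energy of irreducible sets -/

/-- A box of pairs of sites on the two sides of `p`, at distances between `4 * 2 ^ m` and
`6 * 2 ^ m`. -/
noncomputable def straddling (m : ℕ) (p : ℤ) : Finset (ℤ × ℤ) :=
  Finset.Ioc (p - 3 * 2 ^ m) (p - 2 * 2 ^ m) ×ˢ Finset.Ioc (p + 2 * 2 ^ m) (p + 3 * 2 ^ m)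

theorem mem_straddling {m : ℕ} {p x y : ℤ} : (x, y) ∈ straddling m p ↔
    (p - 3 * 2 ^ m < x ∧ x ≤ p - 2 * 2 ^ m) ∧ p + 2 * 2 ^ m < y ∧ y ≤ p + 3 * 2 ^ m := by
  simp [straddling]

theorem le_bondMeasure_finset (α : ℝ) (S : Finset (ℤ × ℤ)) {c : ℝ≥0∞}
    (hc : ∀ p ∈ S, c ≤ bond α p) : S.card * c ≤ bondMeasure α S := by
  rw [bondMeasure_apply]
  calc S.card * c = ∑ _p ∈ S, c := by simp
    _ ≤ ∑ p ∈ S, (S : Set (ℤ × ℤ)).indicator (bond α) p :=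
        Finset.sum_le_sum fun p hp => by
          rw [Set.indicator_of_mem (by exact_mod_cast hp)]; exact hc p hp
    _ ≤ _ := ENNReal.sum_le_tsum _

theorem le_bondMeasure_straddling {α : ℝ} (hα0 : 0 ≤ α) (hα : α ≤ 2) (m : ℕ) (p : ℤ) :
    1 ≤ 36 * bondMeasure α (straddling m p) := by
  have hcard : (straddling m p).card = 2 ^ m * 2 ^ m := by
    rw [straddling, Finset.card_product, Int.card_Ioc, Int.card_Ioc]
    congr 1
    · rw [show p - 2 * 2 ^ m - (p - 3 * 2 ^ m) = ((2 ^ m : ℕ) : ℤ) by push_cast; ring,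
        Int.toNat_natCast]
    · rw [show p + 3 * 2 ^ m - (p + 2 * 2 ^ m) = ((2 ^ m : ℕ) : ℤ) by push_cast; ring,
        Int.toNat_natCast]
  have hb := le_bondMeasure_finset α (straddling m p)
    (c := ENNReal.ofReal (36 * (2 ^ m * 2 ^ m))⁻¹) (by
      rintro ⟨x, y⟩ hxy
      rw [mem_straddling] at hxy
      rw [bond]
      apply ENNReal.ofReal_le_ofReal
      have hpos : (0 : ℤ) < 2 ^ m := by positivity
      have h0 : (x - y).natAbs ≠ 0 := by omega
      have h6 : (x - y).natAbs ≤ 6 * 2 ^ m := by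
        zify
        rw [abs_le]
        omega
      refine le_trans ?_ (coupling_anti hα0 h0 h6)
      rw [coupling, if_neg (by positivity)]
      calc (36 * (2 ^ m * 2 ^ m) : ℝ)⁻¹ = ((6 * 2 ^ m : ℕ) : ℝ) ^ (-2 : ℝ) := by
            rw [Real.rpow_neg (by positivity)]
            rw [show (2 : ℝ) = ((2 : ℕ) : ℝ) by norm_num, Real.rpow_natCast]
            push_cast
            congr 1
            ring
        _ ≤ _ := Real.rpow_le_rpow_of_exponent_le (by
            have : 0 < 6 * 2 ^ m := by positivity
            exact_mod_cast Nat.succ_le_of_lt this) (by linarith))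
  rw [hcard] at hb
  refine le_trans (le_of_eq ?_) (mul_le_mul_right hb 36)
  have h36 : (36 : ℝ≥0∞) = ENNReal.ofReal 36 := by norm_num
  have h2 : ((2 ^ m * 2 ^ m : ℕ) : ℝ≥0∞) = ENNReal.ofReal (2 ^ m * 2 ^ m) := by
    rw [← ENNReal.ofReal_natCast]; norm_num
  rw [h36, h2, ← ENNReal.ofReal_mul (by positivity), ← ENNReal.ofReal_mul (by positivity),
    ← mul_assoc, mul_inv_cancel₀ (by positivity), ENNReal.ofReal_one]

theorem straddling_subset_cut {k : ℕ} (hk : 4 ≤ k) {γ : Finset ℤ} {m : ℕ}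
    (hirr : ∀ C, ¬IsCluster k (m + 2) γ C) {p : ℤ} (hp : p ∈ isolated k m γ) :
    (straddling m p : Set (ℤ × ℤ)) ⊆ cut (vol γ) := by
  classical
  rintro ⟨x, y⟩ hxy
  rw [Finset.mem_coe, mem_straddling] at hxy
  simp only [isolated, Finset.mem_filter] at hp
  obtain ⟨hpn, hiso⟩ := hp
  have hpos : (0 : ℤ) < 2 ^ m := by positivity
  have h16 := sixteen_mul_le_reach hk (m + 2)
  have hm1 : (2 : ℤ) ^ (m + 1) = 2 * 2 ^ m := by ring
  have hm2 : (2 : ℤ) ^ (m + 2) = 4 * 2 ^ m := by ring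
  rw [hm1] at hiso
  rw [hm2] at h16
  rw [mem_cut_vol_iff γ (by omega)]
  by_contra hodd
  rw [Nat.not_odd_iff_even] at hodd
  refine hirr (γ.filter fun r => x ≤ r ∧ r < y)
    ⟨Finset.filter_subset _ _, ⟨p, ?_⟩, hodd, ?_, ?_⟩
  · rw [Finset.mem_filter]
    exact ⟨net_subset m γ hpn, by omega, by omega⟩
  · intro r hr s hs
    rw [Finset.mem_filter] at hr hs
    have h1 := hiso r hr.1
    have h2 := hiso s hs.1
    rw [abs_le, le_abs] at h1 h2
    rw [hm2, abs_le]
    omega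
  · intro r hr s hs hsn
    rw [Finset.mem_filter] at hr hsn
    have h1 := hiso r hr.1
    have h2 := hiso s hs
    rw [abs_le, le_abs] at h1 h2
    rw [le_abs]
    by_cases hs1 : x ≤ s
    · by_cases hs2 : s < y
      · exact absurd ⟨hs, hs1, hs2⟩ hsn
      · omega
    · omega

theorem disjoint_straddling {m m' : ℕ} {γ : Finset ℤ} {p p' : ℤ} (hp : p ∈ net m γ)
    (hp' : p' ∈ net m' γ) (hne : m ≠ m' ∨ p ≠ p') :
    Disjoint (straddling m p : Set (ℤ × ℤ)) (straddling m' p') := by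
  rw [Set.disjoint_left]
  rintro ⟨x, y⟩ h h'
  rw [Finset.mem_coe, mem_straddling] at h h'
  have hlt : ∀ a b : ℕ, a < b → 2 * (2 : ℤ) ^ a ≤ 2 ^ b := by
    intro a b hab
    rw [← pow_succ']
    exact pow_le_pow_right₀ (by norm_num) hab
  rcases lt_trichotomy m m' with hm | rfl | hm
  · have := hlt _ _ hm; omega
  · have := isSpread_net m γ p hp p' hp' (by tauto)
    rw [lt_abs] at this
    omega
  · have := hlt _ _ hm; omega

theorem sum_card_isolated_le {α : ℝ} (hα0 : 0 ≤ α) (hα : α ≤ 2) {k : ℕ} (hk : 4 ≤ k)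
    {γ : Finset ℤ} {n : ℕ} (hirr : ∀ m < n, ∀ C, ¬IsCluster k m γ C) :
    ((∑ m ∈ Finset.range (n - 2), (isolated k m γ).card : ℕ) : ℝ≥0∞) ≤
      36 * bondMeasure α (cut (vol γ)) := by
  classical
  set I := (Finset.range (n - 2)).sigma fun m => isolated k m γ
  have hnet : ∀ m p, p ∈ isolated k m γ → p ∈ net m γ := fun m p hp => (Finset.mem_filter.1 hp).1
  calc ((∑ m ∈ Finset.range (n - 2), (isolated k m γ).card : ℕ) : ℝ≥0∞)
      = ∑ _i ∈ I, 1 := by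
        rw [Finset.sum_const, nsmul_eq_mul, mul_one, Finset.card_sigma]
    _ ≤ ∑ i ∈ I, 36 * bondMeasure α (straddling i.1 i.2) :=
        Finset.sum_le_sum fun i _ => le_bondMeasure_straddling hα0 hα i.1 i.2
    _ = 36 * bondMeasure α (⋃ i ∈ I, (straddling i.1 i.2 : Set (ℤ × ℤ))) := by
        rw [← Finset.mul_sum, measure_biUnion_finset]
        · rintro ⟨m, p⟩ hi ⟨m', p'⟩ hi' hne
          simp only [I, Finset.coe_sigma, Set.mem_sigma_iff, Finset.mem_coe] at hi hi'
          refine disjoint_straddling (hnet _ _ hi.2) (hnet _ _ hi'.2) ?_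
          by_contra! hc
          obtain ⟨rfl, rfl⟩ := hc
          exact hne rfl
        · exact fun _ _ => MeasurableSet.of_discrete
    _ ≤ _ := by
        gcongr
        refine Set.iUnion₂_subset fun i hi => ?_
        simp only [I, Finset.mem_sigma, Finset.mem_range] at hi
        exact straddling_subset_cut hk (hirr (i.1 + 2) (by omega)) hi.2

theorem card_le_bondMeasure_cut (α : ℝ) (γ : Finset ℤ) :
    (γ.card : ℝ≥0∞) ≤ bondMeasure α (cut (vol γ)) := by
  have hinj : Function.Injective fun p : ℤ => (p, p + 1) := fun a b h => by
    simp only [Prod.mk.injEq] at h; exact h.1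
  have h := le_bondMeasure_finset α (γ.image fun p => (p, p + 1)) (c := 1) (by
    intro q hq
    obtain ⟨p, _, rfl⟩ := Finset.mem_image.1 hq
    simp [bond, coupling])
  rw [Finset.card_image_of_injective _ hinj, mul_one] at h
  refine h.trans (measure_mono ?_)
  intro q hq
  rw [Finset.mem_coe, Finset.mem_image] at hq
  obtain ⟨p, hp, rfl⟩ := hq
  rw [mem_cut_vol_iff γ (by omega)]
  have : γ.filter (fun r => p ≤ r ∧ r < p + 1) = {p} := by
    ext r
    simp only [Finset.mem_filter, Finset.mem_singleton]
    constructor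
    · rintro ⟨_, h1, h2⟩; omega
    · rintro rfl; exact ⟨hp, by omega, by omega⟩
  rw [this]
  simp

/-- The energy of an irreducible set of boundary points dominates its multiscale complexity. -/
theorem sum_card_net_le {α : ℝ} (hα0 : 0 ≤ α) (hα : α ≤ 2) {k : ℕ} (hk : 4 ≤ k)
    {γ : Finset ℤ} {n : ℕ} (hirr : ∀ m < n, ∀ C, ¬IsCluster k m γ C) :
    ((∑ m ∈ Finset.range (n + 1), (net m γ).card : ℕ) : ℝ≥0∞) ≤
      (3 * (k + 42) : ℕ) * bondMeasure α (cut (vol γ)) := by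
  have h1 := sum_le_of_contracting (a := fun m => (net m γ).card)
    (g := fun m => (isolated k m γ).card) (K := k + 6) (n := n)
    (fun _ _ h => card_net_anti γ h) (fun m m' h _ => two_mul_card_net_le k γ h) (by omega)
  have h2 := sum_card_isolated_le hα0 hα hk hirr
  have h3 := card_le_bondMeasure_cut α γ
  have h4 : (net 0 γ).card ≤ γ.card := Finset.card_le_card (net_subset 0 γ)
  have h5 : ∑ m ∈ Finset.range (n + 1), (net m γ).card ≤
      3 * ((k + 6) * γ.card + ∑ m ∈ Finset.range (n - 2), (isolated k m γ).card) :=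
    h1.trans (by gcongr)
  calc ((∑ m ∈ Finset.range (n + 1), (net m γ).card : ℕ) : ℝ≥0∞)
      ≤ ((3 * ((k + 6) * γ.card + ∑ m ∈ Finset.range (n - 2), (isolated k m γ).card) : ℕ) :
          ℝ≥0∞) := by exact_mod_cast h5
    _ = 3 * ((k + 6) * γ.card +
          (∑ m ∈ Finset.range (n - 2), (isolated k m γ).card : ℕ)) := by push_cast; ring
    _ ≤ 3 * ((k + 6) * bondMeasure α (cut (vol γ)) + 36 * bondMeasure α (cut (vol γ))) := by
        gcongr
    _ = _ := by push_cast; ring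

/-! ### Counting sets of boundary points by their dyadic complexity -/

/-- The number of dyadic intervals of length `2 ^ m` which meet `γ`. -/
def dyadicCount (m : ℕ) (γ : Finset ℤ) : ℕ := (γ.image (· / 2 ^ m)).card

/-- The number of dyadic intervals of length at most `2 ^ n` which meet `γ`. -/
def complexity (n : ℕ) (γ : Finset ℤ) : ℕ := ∑ m ∈ Finset.range (n + 1), dyadicCount m γ

theorem card_le_net_of_parity {m : ℕ} {γ I : Finset ℤ} (hI : I ⊆ γ.image (· / 2 ^ m))
    (hpar : ∀ i ∈ I, ∀ j ∈ I, i ≠ j → 2 ≤ |i - j|) : I.card ≤ (net m γ).card := by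
  have hr : ∀ i : ℤ, ∃ r, i ∈ I → r ∈ γ ∧ r / 2 ^ m = i := by
    intro i
    by_cases hi : i ∈ I
    · obtain ⟨r, hr, hri⟩ := Finset.mem_image.1 (hI hi)
      exact ⟨r, fun _ => ⟨hr, hri⟩⟩
    · exact ⟨0, fun h => absurd h hi⟩
  choose r hr using hr
  have hinj : Set.InjOn r (I : Set ℤ) := fun i hi j hj hij => by
    rw [← (hr i hi).2, ← (hr j hj).2, hij]
  rw [← Finset.card_image_of_injOn hinj]
  refine IsSpread.card_le ?_ ?_
  · intro p hp q hq hpq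
    obtain ⟨i, hi, rfl⟩ := Finset.mem_image.1 hp
    obtain ⟨j, hj, rfl⟩ := Finset.mem_image.1 hq
    have hij : i ≠ j := fun h => hpq (by rw [h])
    have h2 := hpar i hi j hj hij
    have hpos : (0 : ℤ) < 2 ^ m := by positivity
    have a1 := Int.ediv_mul_le (r i) hpos.ne'
    have a2 := Int.lt_ediv_add_one_mul_self (r i) hpos
    have b1 := Int.ediv_mul_le (r j) hpos.ne'
    have b2 := Int.lt_ediv_add_one_mul_self (r j) hpos
    rw [(hr i hi).2] at a1 a2
    rw [(hr j hj).2] at b1 b2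
    rw [lt_abs]
    rcases le_abs.1 h2 with h | h
    · left; nlinarith
    · right; nlinarith
  · intro p hp
    obtain ⟨i, hi, rfl⟩ := Finset.mem_image.1 hp
    exact (hr i hi).1

theorem dyadicCount_le (m : ℕ) (γ : Finset ℤ) : dyadicCount m γ ≤ 2 * (net m γ).card := by
  have h := Finset.card_filter_add_card_filter_not (s := γ.image (· / 2 ^ m)) (fun i => Even i)
  have h1 : ((γ.image (· / 2 ^ m)).filter fun i => Even i).card ≤ (net m γ).card := by
    refine card_le_net_of_parity (Finset.filter_subset _ _) fun i hi j hj hij => ?_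
    obtain ⟨a, ha⟩ := (Finset.mem_filter.1 hi).2
    obtain ⟨b, hb⟩ := (Finset.mem_filter.1 hj).2
    rw [le_abs]
    omega
  have h2 : ((γ.image (· / 2 ^ m)).filter fun i => ¬Even i).card ≤ (net m γ).card := by
    refine card_le_net_of_parity (Finset.filter_subset _ _) fun i hi j hj hij => ?_
    obtain ⟨a, ha⟩ := Int.not_even_iff_odd.1 (Finset.mem_filter.1 hi).2
    obtain ⟨b, hb⟩ := Int.not_even_iff_odd.1 (Finset.mem_filter.1 hj).2
    rw [le_abs]
    omega
  rw [dyadicCount]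
  omega

theorem complexity_le (n : ℕ) (γ : Finset ℤ) :
    complexity n γ ≤ 2 * ∑ m ∈ Finset.range (n + 1), (net m γ).card := by
  rw [complexity, Finset.mul_sum]
  exact Finset.sum_le_sum fun m _ => dyadicCount_le m γ

theorem complexity_union {n : ℕ} {v : ℤ} {B B' : Finset ℤ} (h : ∀ p ∈ B, p < v * 2 ^ n)
    (h' : ∀ p ∈ B', v * 2 ^ n ≤ p) : complexity n (B ∪ B') = complexity n B + complexity n B' := by
  rw [complexity, complexity, complexity, ← Finset.sum_add_distrib]
  refine Finset.sum_congr rfl fun m hm => ?_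
  rw [Finset.mem_range] at hm
  rw [dyadicCount, dyadicCount, dyadicCount, Finset.image_union, Finset.card_union_of_disjoint]
  rw [Finset.disjoint_left]
  intro i hi hi'
  obtain ⟨p, hp, rfl⟩ := Finset.mem_image.1 hi
  obtain ⟨q, hq, hpq⟩ := Finset.mem_image.1 hi'
  have hpos : (0 : ℤ) < 2 ^ m := by positivity
  have hv : v * 2 ^ n = (v * 2 ^ (n - m)) * 2 ^ m := by
    rw [mul_assoc, ← pow_add, Nat.sub_add_cancel (by omega)]
  have h1 := h p hp
  have h2 := h' q hq
  rw [hv] at h1 h2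
  have h3 := (Int.ediv_lt_iff_lt_mul hpos).2 h1
  have h4 := (Int.le_ediv_iff_mul_le hpos).2 h2
  omega

/-- The generating function of the complexity of the subsets of `U`. -/
def complexitySum (q : ℝ) (n : ℕ) (U : Finset ℤ) : ℝ := ∑ B ∈ U.powerset, q ^ complexity n B

theorem complexitySum_union (q : ℝ) {n : ℕ} {v : ℤ} {U U' : Finset ℤ}
    (h : ∀ p ∈ U, p < v * 2 ^ n) (h' : ∀ p ∈ U', v * 2 ^ n ≤ p) :
    complexitySum q n (U ∪ U') = complexitySum q n U * complexitySum q n U' := by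
  rw [complexitySum, complexitySum, complexitySum, Finset.sum_mul_sum, ← Finset.sum_product']
  have hd : ∀ p ∈ U, p ∉ U' := fun p hp hp' => by
    have := h p hp; have := h' p hp'; omega
  refine Finset.sum_nbij' (fun B => (B ∩ U, B ∩ U')) (fun P => P.1 ∪ P.2) ?_ ?_ ?_ ?_ ?_
  · intro B _
    simp [Finset.inter_subset_right]
  · rintro ⟨P, P'⟩ hP
    simp only [Finset.mem_product, Finset.mem_powerset] at hP ⊢
    exact Finset.union_subset_union hP.1 hP.2
  · intro B hB
    rw [Finset.mem_powerset] at hB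
    simp only
    rw [← Finset.inter_union_distrib_left, Finset.inter_eq_left.2 hB]
  · rintro ⟨P, P'⟩ hP
    simp only [Finset.mem_product, Finset.mem_powerset] at hP
    obtain ⟨hP1, hP2⟩ := hP
    simp only [Prod.mk.injEq]
    constructor
    · ext p
      simp only [Finset.mem_inter, Finset.mem_union]
      grind
    · ext p
      simp only [Finset.mem_inter, Finset.mem_union]
      grind
  · intro B hB
    rw [Finset.mem_powerset] at hB
    simp only
    rw [← pow_add, ← complexity_union (v := v) (n := n)]
    · rw [← Finset.inter_union_distrib_left, Finset.inter_eq_left.2 hB]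
    · exact fun p hp => h p (Finset.mem_inter.1 hp).2
    · exact fun p hp => h' p (Finset.mem_inter.1 hp).2

theorem complexity_empty (n : ℕ) : complexity n ∅ = 0 := by simp [complexity, dyadicCount]

theorem complexitySum_eq (q : ℝ) (n : ℕ) (U : Finset ℤ) :
    complexitySum q n U = 1 + ∑ B ∈ U.powerset.erase ∅, q ^ complexity n B := by
  rw [complexitySum, ← Finset.add_sum_erase _ _ (Finset.empty_mem_powerset U), complexity_empty,
    pow_zero]

/-- The dyadic interval of length `2 ^ n` with index `u`. -/
noncomputable def dyadic (n : ℕ) (u : ℤ) : Finset ℤ := Finset.Ico (u * 2 ^ n) ((u + 1) * 2 ^ n)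

theorem complexitySum_dyadic_le {q : ℝ} (hq0 : 0 ≤ q) (hq : q ≤ 1 / 3) (n : ℕ) (u : ℤ) :
    complexitySum q n (dyadic n u) ≤ 1 + q * (3 * q) ^ n := by
  induction n generalizing u with
  | zero =>
    have hd : dyadic 0 u = {u} := by
      ext x; simp only [dyadic, Finset.mem_Ico, Finset.mem_singleton]; omega
    rw [hd, complexitySum, show ({u} : Finset ℤ) = insert u ∅ from rfl,
      Finset.sum_powerset_insert (by simp)]
    simp [complexity, dyadicCount]
  | succ n ih =>
    have hsplit : dyadic (n + 1) u = dyadic n (2 * u) ∪ dyadic n (2 * u + 1) := by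
      ext x
      simp only [dyadic, Finset.mem_Ico, Finset.mem_union, pow_succ]
      have h1 : u * (2 ^ n * 2) = 2 * u * 2 ^ n := by ring
      have h2 : (u + 1) * (2 ^ n * 2) = (2 * u + 1 + 1) * 2 ^ n := by ring
      have h3 : (2 * u + 1) * (2 : ℤ) ^ n = 2 * u * 2 ^ n + 2 ^ n := by ring
      have h4 : (2 * u + 1 + 1) * (2 : ℤ) ^ n = 2 * u * 2 ^ n + 2 * 2 ^ n := by ring
      have : (0 : ℤ) < 2 ^ n := by positivity
      rw [h1, h2, h4, h3]
      omega
    have hmul : complexitySum q n (dyadic (n + 1) u) =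
        complexitySum q n (dyadic n (2 * u)) * complexitySum q n (dyadic n (2 * u + 1)) := by
      rw [hsplit]
      refine complexitySum_union q (v := 2 * u + 1) ?_ ?_
      · intro p hp
        exact (Finset.mem_Ico.1 hp).2
      · intro p hp
        exact (Finset.mem_Ico.1 hp).1
    have htop : ∀ B ∈ (dyadic (n + 1) u).powerset.erase ∅,
        complexity (n + 1) B = complexity n B + 1 := by
      intro B hB
      rw [Finset.mem_erase, Finset.mem_powerset] at hB
      rw [complexity, Finset.sum_range_succ, ← complexity]
      congr 1
      rw [dyadicCount, Finset.card_eq_one]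
      refine ⟨u, ?_⟩
      refine Finset.eq_singleton_iff_nonempty_unique_mem.2
        ⟨(Finset.nonempty_iff_ne_empty.2 hB.1).image _, fun i hi => ?_⟩
      obtain ⟨p, hp, rfl⟩ := Finset.mem_image.1 hi
      have hp' := Finset.mem_Ico.1 (hB.2 hp)
      have hpos : (0 : ℤ) < 2 ^ (n + 1) := by positivity
      have h3 := (Int.ediv_lt_iff_lt_mul hpos).2 hp'.2
      have h4 := (Int.le_ediv_iff_mul_le hpos).2 hp'.1
      omega
    have hF : ∑ B ∈ (dyadic (n + 1) u).powerset.erase ∅, q ^ complexity (n + 1) B =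
        q * (complexitySum q n (dyadic (n + 1) u) - 1) := by
      rw [complexitySum_eq, add_sub_cancel_left, Finset.mul_sum]
      refine Finset.sum_congr rfl fun B hB => ?_
      rw [htop B hB, pow_succ, mul_comm]
    have h1 := ih (2 * u)
    have h2 := ih (2 * u + 1)
    have hc : 0 ≤ complexitySum q n (dyadic n (2 * u)) :=
      Finset.sum_nonneg fun _ _ => by positivity
    have hx0 : 0 ≤ q * (3 * q) ^ n := by positivity
    have hx1 : q * (3 * q) ^ n ≤ 1 := by
      have : (3 * q) ^ n ≤ 1 := pow_le_one₀ (by linarith) (by linarith)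
      nlinarith
    rw [complexitySum_eq, hF, hmul]
    have h3 : complexitySum q n (dyadic n (2 * u)) * complexitySum q n (dyadic n (2 * u + 1)) ≤
        (1 + q * (3 * q) ^ n) * (1 + q * (3 * q) ^ n) :=
      mul_le_mul h1 h2 (Finset.sum_nonneg fun _ _ => by positivity) (by linarith)
    have h4 : complexitySum q n (dyadic n (2 * u)) * complexitySum q n (dyadic n (2 * u + 1)) - 1
        ≤ 3 * (q * (3 * q) ^ n) := by nlinarith
    calc 1 + q * (complexitySum q n (dyadic n (2 * u)) *
            complexitySum q n (dyadic n (2 * u + 1)) - 1)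
        ≤ 1 + q * (3 * (q * (3 * q) ^ n)) := by gcongr
      _ = _ := by ring

theorem sum_complexity_le {q : ℝ} (hq0 : 0 ≤ q) (hq : q ≤ 1 / 3) (n : ℕ) :
    ∑ B ∈ (Finset.Ico (-2 ^ n : ℤ) (2 ^ n)).powerset.erase ∅, q ^ complexity n B ≤
      (3 * q) ^ (n + 1) := by
  have hpos : (0 : ℤ) < 2 ^ n := by positivity
  have hsplit : Finset.Ico (-2 ^ n : ℤ) (2 ^ n) = dyadic n (-1) ∪ dyadic n 0 := by
    ext x
    simp only [dyadic, Finset.mem_Ico, Finset.mem_union]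
    omega
  have hmul : complexitySum q n (Finset.Ico (-2 ^ n : ℤ) (2 ^ n)) =
      complexitySum q n (dyadic n (-1)) * complexitySum q n (dyadic n 0) := by
    rw [hsplit]
    refine complexitySum_union q (v := 0) ?_ ?_
    · intro p hp
      have := (Finset.mem_Ico.1 hp).2
      omega
    · intro p hp
      exact (Finset.mem_Ico.1 hp).1
  have h1 := complexitySum_dyadic_le hq0 hq n (-1)
  have h2 := complexitySum_dyadic_le hq0 hq n 0
  have hx0 : 0 ≤ q * (3 * q) ^ n := by positivity
  have hx1 : q * (3 * q) ^ n ≤ 1 := by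
    have : (3 * q) ^ n ≤ 1 := pow_le_one₀ (by linarith) (by linarith)
    nlinarith
  have h3 : complexitySum q n (dyadic n (-1)) * complexitySum q n (dyadic n 0) ≤
      (1 + q * (3 * q) ^ n) * (1 + q * (3 * q) ^ n) :=
    mul_le_mul h1 h2 (Finset.sum_nonneg fun _ _ => by positivity) (by linarith)
  rw [complexitySum_eq] at hmul
  rw [pow_succ]
  nlinarith

theorem sum_sum_complexity_le (N : ℕ) :
    ∑ n ∈ Finset.range N, ∑ B ∈ (Finset.Ico (-2 ^ n : ℤ) (2 ^ n)).powerset.erase ∅,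
      (1 / 15 : ℝ) ^ complexity n B ≤ 1 / 4 := by
  calc _ ≤ ∑ n ∈ Finset.range N, (3 * (1 / 15) : ℝ) ^ (n + 1) :=
        Finset.sum_le_sum fun n _ => sum_complexity_le (by norm_num) (by norm_num) n
    _ = (1 / 5) * ∑ n ∈ Finset.range N, (1 / 5 : ℝ) ^ n := by
        rw [Finset.mul_sum]
        refine Finset.sum_congr rfl fun n _ => ?_
        rw [pow_succ]; norm_num; ring
    _ ≤ (1 / 5) * (5 / 4) := by
        gcongr
        have := geom_sum_Ico_le_of_lt_one (m := 0) (n := N) (x := (1 / 5 : ℝ)) (by norm_num)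
          (by norm_num)
        rw [Finset.range_eq_Ico]
        refine this.trans (by norm_num)
    _ = _ := by norm_num

/-! ### Surface energies of finite sets of sites -/

theorem cut_subset_far (V : Set ℤ) :
    cut V ⊆ {p | p.1 ∈ V ∧ (2 : ℤ) ^ 0 ≤ |p.1 - p.2|} ∪
      Prod.swap ⁻¹' {p | p.1 ∈ V ∧ (2 : ℤ) ^ 0 ≤ |p.1 - p.2|} := by
  rintro ⟨x, y⟩ h
  have hne : x ≠ y := by rintro rfl; exact h Iff.rfl
  have h1 : (1 : ℤ) ≤ |x - y| := Int.one_le_abs (sub_ne_zero.2 hne)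
  have h2 : (1 : ℤ) ≤ |y - x| := Int.one_le_abs (sub_ne_zero.2 hne.symm)
  simp only [cut, Set.mem_ofPred_eq] at h
  by_cases hx : x ∈ V
  · left; exact ⟨hx, by simpa using h1⟩
  · right; exact ⟨by simp only [Prod.fst_swap]; tauto, by simpa using h2⟩

theorem bondMeasure_cut_ne_top {α : ℝ} (hα : 1 < α) (Λ : Finset ℤ) :
    bondMeasure α (cut Λ) ≠ ∞ := by
  classical
  have h : bondMeasure α {p | p.1 ∈ (Λ : Set ℤ) ∧ (2 : ℤ) ^ 0 ≤ |p.1 - p.2|} ≠ ∞ := by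
    refine ne_top_of_le_ne_top ?_ (bondMeasure_far_le α (Λ : Set ℤ) 0)
    rw [tsum_eq_sum (s := Λ) (fun x hx => by simp [hx])]
    refine ENNReal.sum_ne_top.2 fun x _ => ?_
    split_ifs
    · exact ENNReal.mul_ne_top (by norm_num) (tail_ne_top hα 0)
    · exact ENNReal.zero_ne_top
  refine ne_top_of_le_ne_top ?_
    ((measure_mono (cut_subset_far (Λ : Set ℤ))).trans (measure_union_le _ _))
  rw [bondMeasure_preimage_swap]
  exact ENNReal.add_ne_top.2 ⟨h, h⟩

/-- The energy of the interface of `Λ`: the total coupling of the ordered pairs it separates. -/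
noncomputable def surface (α : ℝ) (Λ : Finset ℤ) : ℝ := (bondMeasure α (cut Λ)).toReal

theorem surface_nonneg (α : ℝ) (Λ : Finset ℤ) : 0 ≤ surface α Λ := ENNReal.toReal_nonneg

theorem bondMeasure_cut_eq_two_mul (α : ℝ) (V : Set ℤ) (R : Set (ℤ × ℤ))
    (hR : ∀ p ∈ cut V, p ∈ R ↔ p.swap ∉ R) :
    bondMeasure α (cut V) = 2 * bondMeasure α (cut V ∩ R) := by
  have h1 : cut V = (cut V ∩ R) ∪ Prod.swap ⁻¹' (cut V ∩ R) := by
    ext ⟨x, y⟩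
    simp only [Set.mem_union, Set.mem_inter_iff, Set.mem_preimage, Prod.swap_prod_mk,
      swap_mem_cut]
    constructor
    · intro h
      have := hR _ h
      simp only [Prod.swap_prod_mk] at this
      tauto
    · rintro (⟨h, _⟩ | ⟨h, _⟩) <;> exact h
  have h2 : Disjoint (cut V ∩ R) (Prod.swap ⁻¹' (cut V ∩ R)) := by
    rw [Set.disjoint_left]
    rintro p ⟨h3, h4⟩ ⟨_, h6⟩
    exact (hR p h3).1 h4 h6
  conv_lhs => rw [h1]
  rw [measure_union h2 MeasurableSet.of_discrete, bondMeasure_preimage_swap, two_mul]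

theorem bond_ne_top (α : ℝ) (p : ℤ × ℤ) : bond α p ≠ ∞ := ENNReal.ofReal_ne_top

theorem toReal_bond (α : ℝ) (p : ℤ × ℤ) :
    (bond α p).toReal = coupling α (p.1 - p.2).natAbs :=
  ENNReal.toReal_ofReal (coupling_nonneg _ _)

theorem surface_eq_sum_tsum {α : ℝ} (hα : 1 < α) (Λ : Finset ℤ) :
    surface α Λ =
      2 * ∑ x ∈ Λ, ∑' y : {y : ℤ // y ∉ Λ}, |(x : ℝ) - ((y : ℤ) : ℝ)| ^ (-α) := by
  have h0 := bondMeasure_cut_eq_two_mul α (Λ : Set ℤ) {p | p.1 ∈ Λ} (by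
    rintro ⟨x, y⟩ h
    simp only [cut, Set.mem_ofPred_eq, Finset.mem_coe, Prod.swap_prod_mk] at h ⊢
    tauto)
  have h1 : bondMeasure α (cut Λ ∩ {p | p.1 ∈ Λ}) =
      ∑ x ∈ Λ, ∑' y : {y : ℤ // y ∉ Λ}, bond α (x, y) := by
    rw [bondMeasure_apply, ENNReal.tsum_prod', tsum_eq_sum (s := Λ)]
    · refine Finset.sum_congr rfl fun x hx => ?_
      refine Eq.trans ?_ (tsum_subtype {y : ℤ | y ∉ Λ} fun y => bond α (x, y)).symm
      refine tsum_congr fun y => ?_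
      simp [Set.indicator, cut, hx]
    · intro x hx
      simp [Set.indicator, hx]
  have hfin : bondMeasure α (cut Λ ∩ {p | p.1 ∈ Λ}) ≠ ∞ :=
    ne_top_of_le_ne_top (bondMeasure_cut_ne_top hα Λ) (measure_mono Set.inter_subset_left)
  rw [surface, h0, ENNReal.toReal_mul, ENNReal.toReal_ofNat, h1, ENNReal.toReal_sum]
  · congr 1
    refine Finset.sum_congr rfl fun x hx => ?_
    rw [ENNReal.tsum_toReal_eq fun _ => bond_ne_top _ _]
    refine tsum_congr fun y => ?_
    rw [toReal_bond, coupling_eq_rpow (by linarith)]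
    congr 1
    rw [Nat.cast_natAbs]
    push_cast
    rfl
  · rw [h1] at hfin
    exact ENNReal.sum_ne_top.1 hfin

theorem surface_inter_add_surface_union_le {α : ℝ} (hα : 1 < α) (A B : Finset ℤ) :
    surface α (A ∩ B) + surface α (A ∪ B) ≤ surface α A + surface α B := by
  rw [surface, surface, surface, surface,
    ← ENNReal.toReal_add (bondMeasure_cut_ne_top hα _) (bondMeasure_cut_ne_top hα _),
    ← ENNReal.toReal_add (bondMeasure_cut_ne_top hα _) (bondMeasure_cut_ne_top hα _)]
  refine ENNReal.toReal_mono (ENNReal.add_ne_top.2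
    ⟨bondMeasure_cut_ne_top hα _, bondMeasure_cut_ne_top hα _⟩) ?_
  rw [← measure_union_add_inter _ (MeasurableSet.of_discrete (s := cut (↑(A ∪ B)))),
    ← measure_union_add_inter (cut (A : Set ℤ)) (MeasurableSet.of_discrete (s := cut (B : Set ℤ)))]
  refine add_le_add (measure_mono ?_) (measure_mono ?_)
  · rintro ⟨x, y⟩
    simp only [cut, Set.mem_union, Set.mem_ofPred_eq, Finset.mem_coe, Finset.mem_inter,
      Finset.mem_union]
    tauto
  · rintro ⟨x, y⟩
    simp only [cut, Set.mem_inter_iff, Set.mem_ofPred_eq, Finset.mem_coe, Finset.mem_inter,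
      Finset.mem_union]
    tauto

theorem surface_sub_surface_symmDiff {α : ℝ} (hα : 1 < α) (Λ V : Finset ℤ) :
    surface α Λ - surface α (symmDiff Λ V) =
      surface α V - 2 * (bondMeasure α (cut V \ cut Λ)).toReal := by
  have hcut : cut (↑(symmDiff Λ V)) =
      (cut (Λ : Set ℤ) \ cut V) ∪ (cut (V : Set ℤ) \ cut Λ) := by
    ext ⟨x, y⟩
    simp only [cut, Set.mem_union, Set.mem_sdiff, Set.mem_ofPred_eq, Finset.mem_coe,
      Finset.mem_symmDiff]
    tauto
  have hdisj : Disjoint (cut (Λ : Set ℤ) \ cut V) (cut (V : Set ℤ) \ cut Λ) := by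
    rw [Set.disjoint_left]
    rintro p ⟨h1, _⟩ ⟨_, h2⟩
    exact h2 h1
  have hΛ := bondMeasure_cut_ne_top hα Λ
  have hV := bondMeasure_cut_ne_top hα V
  have f1 : bondMeasure α (cut (Λ : Set ℤ) \ cut V) ≠ ∞ :=
    ne_top_of_le_ne_top hΛ (measure_mono Set.sdiff_subset)
  have f2 : bondMeasure α (cut (V : Set ℤ) \ cut Λ) ≠ ∞ :=
    ne_top_of_le_ne_top hV (measure_mono Set.sdiff_subset)
  have f3 : bondMeasure α (cut (Λ : Set ℤ) ∩ cut V) ≠ ∞ :=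
    ne_top_of_le_ne_top hΛ (measure_mono Set.inter_subset_left)
  have e1 : surface α Λ = (bondMeasure α (cut (Λ : Set ℤ) ∩ cut V)).toReal +
      (bondMeasure α (cut (Λ : Set ℤ) \ cut V)).toReal := by
    rw [← ENNReal.toReal_add f3 f1, measure_inter_add_sdiff _ MeasurableSet.of_discrete, surface]
  have e2 : surface α V = (bondMeasure α (cut (Λ : Set ℤ) ∩ cut V)).toReal +
      (bondMeasure α (cut (V : Set ℤ) \ cut Λ)).toReal := by
    rw [← ENNReal.toReal_add f3 f2, Set.inter_comm, measure_inter_add_sdiff _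
      MeasurableSet.of_discrete, surface]
  have e3 : surface α (symmDiff Λ V) = (bondMeasure α (cut (Λ : Set ℤ) \ cut V)).toReal +
      (bondMeasure α (cut (V : Set ℤ) \ cut Λ)).toReal := by
    rw [surface, hcut, measure_union hdisj MeasurableSet.of_discrete, ENNReal.toReal_add f1 f2]
  linarith

/-! ### The Gibbs weights -/

/-- The energy of the configuration with spins opposite to the boundary condition exactly on `Λ`,
in the field `s * g`. -/
noncomputable def energy (α : ℝ) (g : ℤ → ℝ) (s : ℝ) (Λ : Finset ℤ) : ℝ :=
  surface α Λ + 2 * s * ∑ x ∈ Λ, g x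

/-- The Gibbs weight of the configuration with spins opposite to the boundary condition exactly
on `Λ`. -/
noncomputable def weight (α : ℝ) (g : ℤ → ℝ) (β s : ℝ) (Λ : Finset ℤ) : ℝ :=
  Real.exp (-β * energy α g s Λ)

theorem weight_pos (α : ℝ) (g : ℤ → ℝ) (β s : ℝ) (Λ : Finset ℤ) : 0 < weight α g β s Λ :=
  Real.exp_pos _

theorem weight_mul_weight_le {α : ℝ} (hα : 1 < α) (g : ℤ → ℝ) {β : ℝ} (hβ : 0 ≤ β) (s : ℝ)
    (A B : Finset ℤ) :
    weight α g β s A * weight α g β s B ≤ weight α g β s (A ∩ B) * weight α g β s (A ∪ B) := by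
  rw [weight, weight, weight, weight, ← Real.exp_add, ← Real.exp_add, Real.exp_le_exp]
  have h1 := surface_inter_add_surface_union_le hα A B
  have h2 := Finset.sum_union_inter (s₁ := A) (s₂ := B) (f := g)
  have h3 : energy α g s (A ∩ B) + energy α g s (A ∪ B) ≤ energy α g s A + energy α g s B := by
    simp only [energy]
    linear_combination h1 + 2 * s * h2
  nlinarith

theorem le_energy_sub_energy_symmDiff {α : ℝ} (hα : 1 < α) {g : ℤ → ℝ} (hg : ∀ x, 0 ≤ g x)
    {s : ℝ} (hs : |s| ≤ 1) (Λ V : Finset ℤ) :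
    surface α V - 2 * (bondMeasure α (cut V \ cut Λ)).toReal - 2 * ∑ x ∈ V, g x ≤
      energy α g s Λ - energy α g s (symmDiff Λ V) := by
  have h1 := surface_sub_surface_symmDiff hα Λ V
  have hsd : symmDiff Λ V = (Λ \ V) ∪ (V \ Λ) := rfl
  have h2 : ∑ x ∈ symmDiff Λ V, g x = ∑ x ∈ Λ \ V, g x + ∑ x ∈ V \ Λ, g x := by
    rw [hsd, Finset.sum_union disjoint_sdiff_sdiff]
  have h3 := Finset.sum_inter_add_sum_sdiff Λ V g
  have h4 := Finset.sum_inter_add_sum_sdiff V Λ g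
  rw [Finset.inter_comm] at h4
  have p1 : 0 ≤ ∑ x ∈ Λ ∩ V, g x := Finset.sum_nonneg fun x _ => hg x
  have p2 : 0 ≤ ∑ x ∈ V \ Λ, g x := Finset.sum_nonneg fun x _ => hg x
  obtain ⟨s1, s2⟩ := abs_le.1 hs
  simp only [energy]
  nlinarith

/-! ### The Peierls argument -/

/-- The part of `vol γ` in the box `[-L, L]`. -/
noncomputable def volIn (L : ℕ) (γ : Finset ℤ) : Finset ℤ :=
  open Classical in (box L).filter (· ∈ vol γ)

theorem coe_volIn {L : ℕ} {Λ γ : Finset ℤ} (hΛ : Λ ⊆ box L) (hγ : γ ⊆ boundary Λ)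
    (heven : Even γ.card) : (volIn L γ : Set ℤ) = vol γ := by
  ext x
  simp only [volIn, Finset.coe_filter, Set.mem_ofPred_eq, and_iff_right_iff_imp]
  intro hx
  obtain ⟨c, hc, d, hd, hcx, hxd⟩ := exists_mem_between_of_mem_vol heven hx
  have hB : ∀ p ∈ γ, -(L : ℤ) - 1 ≤ p ∧ p ≤ L := by
    intro p hp
    have h := mem_boundary.1 (hγ hp)
    by_cases hpΛ : p ∈ Λ
    · have := Finset.mem_Icc.1 (hΛ hpΛ); omega
    · have := Finset.mem_Icc.1 (hΛ (show p + 1 ∈ Λ by tauto)); omega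
  have h1 := hB c hc
  have h2 := hB d hd
  exact Finset.mem_Icc.2 (by omega)

theorem sum_filter_zero_mem_le {L : ℕ} {w : Finset ℤ → ℝ} (hw : ∀ Λ, 0 ≤ w Λ)
    (hred : ∀ Λ ⊆ box L, 0 ∈ Λ → ∃ n, ∃ γ ∈ (Finset.Ico (-2 ^ n : ℤ) (2 ^ n)).powerset.erase ∅,
      w Λ ≤ (1 / 15) ^ complexity n γ * w (symmDiff Λ (volIn L γ))) :
    ∑ Λ ∈ (box L).powerset.filter (0 ∈ ·), w Λ ≤ 1 / 4 * ∑ Λ ∈ (box L).powerset, w Λ := by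
  classical
  set P := (box L).powerset.filter (0 ∈ ·) with hP
  have hex : ∀ Λ : Finset ℤ, ∃ i : Σ _ : ℕ, Finset ℤ, Λ ∈ P →
      i.2 ∈ (Finset.Ico (-2 ^ i.1 : ℤ) (2 ^ i.1)).powerset.erase ∅ ∧
      w Λ ≤ (1 / 15) ^ complexity i.1 i.2 * w (symmDiff Λ (volIn L i.2)) := by
    intro Λ
    by_cases hΛ : Λ ∈ P
    · rw [hP, Finset.mem_filter, Finset.mem_powerset] at hΛ
      obtain ⟨n, γ, hγ, h⟩ := hred Λ hΛ.1 hΛ.2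
      exact ⟨⟨n, γ⟩, fun _ => ⟨hγ, h⟩⟩
    · exact ⟨⟨0, ∅⟩, fun h => absurd h hΛ⟩
  choose F hF using hex
  set N := P.sup (fun Λ => (F Λ).1) + 1
  set I := (Finset.range N).sigma fun n => (Finset.Ico (-2 ^ n : ℤ) (2 ^ n)).powerset.erase ∅
  have hmaps : ∀ Λ ∈ P, F Λ ∈ I := fun Λ hΛ => by
    simp only [I, Finset.mem_sigma, Finset.mem_range]
    exact ⟨Nat.lt_succ_of_le (Finset.le_sup (f := fun Λ => (F Λ).1) hΛ), (hF Λ hΛ).1⟩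
  have hZ : 0 ≤ ∑ Λ ∈ (box L).powerset, w Λ := Finset.sum_nonneg fun Λ _ => hw Λ
  calc ∑ Λ ∈ P, w Λ = ∑ i ∈ I, ∑ Λ ∈ P with F Λ = i, w Λ :=
        (Finset.sum_fiberwise_of_maps_to hmaps w).symm
    _ ≤ ∑ i ∈ I, (1 / 15) ^ complexity i.1 i.2 * ∑ Λ ∈ (box L).powerset, w Λ := by
        refine Finset.sum_le_sum fun i _ => ?_
        calc ∑ Λ ∈ P with F Λ = i, w Λ
            ≤ ∑ Λ ∈ P with F Λ = i,
                (1 / 15) ^ complexity i.1 i.2 * w (symmDiff Λ (volIn L i.2)) := by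
              refine Finset.sum_le_sum fun Λ hΛ => ?_
              rw [Finset.mem_filter] at hΛ
              obtain ⟨hΛ, rfl⟩ := hΛ
              exact (hF Λ hΛ).2
          _ = (1 / 15) ^ complexity i.1 i.2 *
                ∑ Λ ∈ (P.filter (F · = i)).image (symmDiff · (volIn L i.2)), w Λ := by
              rw [← Finset.mul_sum, Finset.sum_image fun a _ b _ h => symmDiff_left_injective _ h]
          _ ≤ _ := by
              refine mul_le_mul_of_nonneg_left ?_ (by positivity)
              refine Finset.sum_le_sum_of_subset_of_nonneg ?_ fun Λ _ _ => hw Λ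
              intro Λ hΛ
              obtain ⟨Λ', hΛ', rfl⟩ := Finset.mem_image.1 hΛ
              rw [Finset.mem_filter, hP, Finset.mem_filter, Finset.mem_powerset] at hΛ'
              rw [Finset.mem_powerset]
              intro x hx
              rcases Finset.mem_symmDiff.1 hx with h | h
              · exact hΛ'.1.1 h.1
              · exact (Finset.mem_filter.1 h.1).1
    _ = (∑ n ∈ Finset.range N, ∑ B ∈ (Finset.Ico (-2 ^ n : ℤ) (2 ^ n)).powerset.erase ∅,
          (1 / 15 : ℝ) ^ complexity n B) * ∑ Λ ∈ (box L).powerset, w Λ := by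
        rw [← Finset.sum_mul, Finset.sum_sigma]
    _ ≤ _ := mul_le_mul_of_nonneg_right (sum_sum_complexity_le N) hZ

theorem exists_peierls_bound {α : ℝ} (hα1 : 1 < α) (hα2 : α ≤ 2) {g : ℤ → ℝ}
    (hg : ∀ x, 0 ≤ g x) {η : ℝ} (hη1 : η < 1)
    (hfield : ∀ Λ : Finset ℤ, 2 * ∑ x ∈ Λ, g x ≤ η * surface α Λ) :
    ∃ βbar : ℝ, 0 < βbar ∧ ∀ β, βbar ≤ β → ∀ s : ℝ, |s| ≤ 1 → ∀ L : ℕ,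
      ∑ Λ ∈ (box L).powerset.filter (0 ∈ ·), weight α g β s Λ ≤
        1 / 4 * ∑ Λ ∈ (box L).powerset, weight α g β s Λ := by
  obtain ⟨k, hk, hscr⟩ := exists_screening_le hα1 (ε := ENNReal.ofReal ((1 - η) / 4))
    (by rw [ENNReal.ofReal_pos]; linarith)
  have hlog : 0 < Real.log 15 := Real.log_pos (by norm_num)
  have hη : 0 < 1 - η := by linarith
  refine ⟨12 * (k + 42) * Real.log 15 / (1 - η), by positivity, fun β hβ s hs L => ?_⟩
  rw [div_le_iff₀ hη] at hβ
  refine sum_filter_zero_mem_le (fun Λ => (weight_pos _ _ _ _ _).le) fun Λ hΛ h0 => ?_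
  have h0' : (0 : ℤ) ∈ vol (boundary Λ) := by rw [vol_boundary]; exact h0
  obtain ⟨n, γ, hγ, hodd⟩ := exists_cluster_odd_filter (k := k) (by omega) (even_card_boundary Λ)
    (· < 0) h0'
  have h0γ : (0 : ℤ) ∈ vol γ := hodd
  refine ⟨n, γ, ?_, ?_⟩
  · rw [Finset.mem_erase, Finset.mem_powerset]
    refine ⟨hγ.nonempty.ne_empty, fun p hp => ?_⟩
    obtain ⟨c, hc, d, hd, hc0, hd0⟩ := exists_mem_between_of_mem_vol hγ.even h0γ
    have h1 := hγ.diam p hp c hc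
    have h2 := hγ.diam p hp d hd
    rw [abs_le] at h1 h2
    rw [Finset.mem_Ico]
    omega
  · have hsub : γ ⊆ boundary Λ := hγ.subset.trans (peel_antitone k _ (Nat.zero_le n))
    have hV := coe_volIn hΛ hsub hγ.even
    set V := volIn L γ
    have hfin := bondMeasure_cut_ne_top hα1 V
    have hcross := bondMeasure_cut_sdiff_le hα1 hα2 hk hγ
    rw [vol_boundary, ← hV] at hcross
    have hcross' : (bondMeasure α (cut V \ cut Λ)).toReal ≤ (1 - η) / 4 * surface α V := by
      have h1 := hcross.trans (mul_le_mul_left hscr _)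
      have h2 := ENNReal.toReal_mono (ENNReal.mul_ne_top ENNReal.ofReal_ne_top hfin) h1
      rwa [ENNReal.toReal_mul, ENNReal.toReal_ofReal (by linarith)] at h2
    have hcomp : (complexity n γ : ℝ) ≤ 6 * (k + 42) * surface α V := by
      have h1 := sum_card_net_le (by linarith : 0 ≤ α) hα2 hk fun m hm => hγ.irreducible hm
      rw [← hV] at h1
      have h2 := ENNReal.toReal_mono (ENNReal.mul_ne_top (ENNReal.natCast_ne_top _) hfin) h1
      rw [ENNReal.toReal_mul, ENNReal.toReal_natCast, ENNReal.toReal_natCast] at h2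
      have h3 : (complexity n γ : ℝ) ≤
          2 * ((∑ m ∈ Finset.range (n + 1), (net m γ).card : ℕ) : ℝ) := by
        exact_mod_cast complexity_le n γ
      push_cast at h2 h3
      rw [surface]
      linarith
    have hen := le_energy_sub_energy_symmDiff hα1 hg hs Λ V
    have hS := surface_nonneg α V
    have hfV := hfield V
    have hgain : (1 - η) / 2 * surface α V ≤
        energy α g s Λ - energy α g s (symmDiff Λ V) := by linarith
    have hpow : (1 / 15 : ℝ) ^ complexity n γ =
        Real.exp (-(complexity n γ * Real.log 15)) := by
      rw [Real.exp_neg, mul_comm, Real.exp_mul, Real.exp_log (by norm_num), Real.rpow_natCast,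
        one_div, inv_pow]
    rw [weight, weight, hpow, ← Real.exp_add, Real.exp_le_exp]
    have hβ0 : 0 ≤ β := by
      have : 0 < 12 * ((k : ℝ) + 42) * Real.log 15 := by positivity
      by_contra hc
      nlinarith
    have h1 := mul_le_mul_of_nonneg_left hgain hβ0
    have h2 := mul_le_mul_of_nonneg_right hcomp hlog.le
    have h3 := mul_le_mul_of_nonneg_right hβ hS
    nlinarith

/-! ### Configurations in a box and finite sets of sites -/

/-- The configuration with spins opposite to the boundary condition exactly on `Λ`. -/
def flipOn (ω : ℤˣ) (Λ : Finset ℤ) : Config := fun x => if x ∈ Λ then -ω else ω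

theorem flipOn_eq_iff (ω : ℤˣ) (Λ : Finset ℤ) (x : ℤ) : flipOn ω Λ x = ω ↔ x ∉ Λ := by
  unfold flipOn
  split_ifs with h
  · simp [h]
  · simp [h]

theorem flipOn_injective (ω : ℤˣ) : Function.Injective (flipOn ω) := by
  intro Λ Λ' h
  ext x
  have h1 := flipOn_eq_iff ω Λ x
  have h2 := flipOn_eq_iff ω Λ' x
  rw [h] at h1
  tauto

theorem boxConfigs_toFinset (ω : ℤˣ) (L : ℕ) :
    (boxConfigs_finite ω L).toFinset = (box L).powerset.map ⟨flipOn ω, flipOn_injective ω⟩ := by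
  ext σ
  simp only [Set.Finite.mem_toFinset, Finset.mem_map, Finset.mem_powerset,
    Function.Embedding.coeFn_mk]
  constructor
  · intro hσ
    refine ⟨(box L).filter (σ · ≠ ω), Finset.filter_subset _ _, ?_⟩
    funext x
    by_cases hx : σ x = ω
    · rw [hx, flipOn_eq_iff]
      simp [hx]
    · have hxb : x ∈ box L := by
        by_contra h; exact hx (hσ x h)
      have : σ x = -ω := by
        rcases Int.units_eq_one_or ω with rfl | rfl <;>
          rcases Int.units_eq_one_or (σ x) with h | h <;> simp_all
      simp [flipOn, hxb, this]
  · rintro ⟨Λ, hΛ, rfl⟩ x hx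
    rw [flipOn_eq_iff]
    exact fun h => hx (hΛ h)

theorem spin_flipOn (ω : ℤˣ) (Λ : Finset ℤ) (x : ℤ) :
    spin x (flipOn ω Λ) = ((ω : ℤ) : ℝ) * (1 - 2 * if x ∈ Λ then 1 else 0) := by
  unfold spin flipOn
  split_ifs
  · push_cast; ring
  · ring

theorem units_cast_mul_self (ω : ℤˣ) : ((ω : ℤ) : ℝ) * ((ω : ℤ) : ℝ) = 1 := by
  rcases Int.units_eq_one_or ω with rfl | rfl <;> simp

theorem hamiltonian_flipOn (α : ℝ) (g : ℤ → ℝ) (ω : ℤˣ) (Λ : Finset ℤ) :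
    hamiltonian α g ω (flipOn ω Λ) = energy α g ((ω : ℤ) : ℝ) Λ := by
  classical
  have hω := units_cast_mul_self ω
  rw [hamiltonian, energy]
  congr 1
  · have h0 := bondMeasure_cut_eq_two_mul α (Λ : Set ℤ) {p | p.1 < p.2} (by
      rintro ⟨x, y⟩ h
      have hne : x ≠ y := by rintro rfl; exact h Iff.rfl
      simp only [Set.mem_ofPred_eq, Prod.swap_prod_mk]
      omega)
    have h1 : bondMeasure α (cut Λ ∩ {p | p.1 < p.2}) =
        ∑' p : {p : ℤ × ℤ // p.1 < p.2}, (cut (Λ : Set ℤ)).indicator (bond α) p := by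
      rw [bondMeasure_apply]
      refine Eq.trans ?_ (tsum_subtype {p : ℤ × ℤ | p.1 < p.2}
        ((cut (Λ : Set ℤ)).indicator (bond α))).symm
      refine tsum_congr fun p => ?_
      rw [Set.indicator_indicator, Set.inter_comm]
    rw [surface, h0, h1, ENNReal.toReal_mul, ENNReal.toReal_ofNat, ENNReal.tsum_toReal_eq,
      ← tsum_mul_left]
    · refine tsum_congr fun p => ?_
      obtain ⟨⟨x, y⟩, hp⟩ := p
      rw [spin_flipOn, spin_flipOn]
      simp only [Set.indicator, cut, Set.mem_ofPred_eq, Finset.mem_coe]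
      by_cases hx : x ∈ Λ <;> by_cases hy : y ∈ Λ <;>
        simp only [hx, hy, if_true, if_false, not_true_eq_false, iff_true, iff_false,
          ENNReal.toReal_zero, toReal_bond, not_false_eq_true, iff_self] <;>
        first
        | linear_combination (-coupling α (x - y).natAbs) * hω
        | linear_combination coupling α (x - y).natAbs * hω
    · intro p
      simp only [Set.indicator]
      split_ifs
      · exact bond_ne_top _ _
      · exact ENNReal.zero_ne_top
  · rw [tsum_eq_sum (s := Λ), Finset.mul_sum]
    · refine Finset.sum_congr rfl fun x hx => ?_
      rw [spin_flipOn, if_pos hx]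
      ring
    · intro x hx
      rw [spin_flipOn, if_neg hx]
      ring

theorem gibbsExpectation_eq (α : ℝ) (g : ℤ → ℝ) (β : ℝ) (ω : ℤˣ) (L : ℕ) (f : Config → ℝ) :
    gibbsExpectation α g β ω L f =
      (∑ Λ ∈ (box L).powerset, f (flipOn ω Λ) * weight α g β ((ω : ℤ) : ℝ) Λ) /
        ∑ Λ ∈ (box L).powerset, weight α g β ((ω : ℤ) : ℝ) Λ := by
  rw [gibbsExpectation, partitionFunction, boxConfigs_toFinset, Finset.sum_map, Finset.sum_map,
    one_div, ← div_eq_inv_mul]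
  simp only [Function.Embedding.coeFn_mk, hamiltonian_flipOn, weight]

theorem sum_weight_pos (α : ℝ) (g : ℤ → ℝ) (β s : ℝ) (L : ℕ) :
    0 < ∑ Λ ∈ (box L).powerset, weight α g β s Λ :=
  Finset.sum_pos (fun Λ _ => weight_pos _ _ _ _ Λ) ⟨∅, Finset.empty_mem_powerset _⟩

theorem gibbsExpectation_add (α : ℝ) (g : ℤ → ℝ) (β : ℝ) (ω : ℤˣ) (L : ℕ) (f f' : Config → ℝ) :
    gibbsExpectation α g β ω L (fun σ => f σ + f' σ) =
      gibbsExpectation α g β ω L f + gibbsExpectation α g β ω L f' := by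
  simp only [gibbsExpectation, add_mul, Finset.sum_add_distrib, mul_add]

theorem gibbsExpectation_const_mul (α : ℝ) (g : ℤ → ℝ) (β : ℝ) (ω : ℤˣ) (L : ℕ) (c : ℝ)
    (f : Config → ℝ) :
    gibbsExpectation α g β ω L (fun σ => c * f σ) = c * gibbsExpectation α g β ω L f := by
  simp only [gibbsExpectation, mul_assoc, ← Finset.mul_sum]
  ring

/-! ### Existence of the infinite-volume limits -/

/-- The indicator that all spins in `S` agree with the boundary condition. -/
noncomputable def agree (ω : ℤˣ) (S : Finset ℤ) : Config → ℝ :=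
  open Classical in fun σ => if ∀ x ∈ S, σ x = ω then 1 else 0

theorem agree_flipOn (ω : ℤˣ) (S Λ : Finset ℤ) :
    agree ω S (flipOn ω Λ) = if Disjoint Λ S then 1 else 0 := by
  simp only [agree, flipOn_eq_iff, Finset.disjoint_right]

theorem agree_insert (ω : ℤˣ) (S : Finset ℤ) (a : ℤ) (σ : Config) :
    agree ω (insert a S) σ = (if σ a = ω then 1 else 0) * agree ω S σ := by
  simp only [agree, Finset.forall_mem_insert]
  split_ifs <;> simp_all

open scoped FinsetFamily in
theorem gibbsExpectation_agree_anti {α : ℝ} (hα : 1 < α) (g : ℤ → ℝ) {β : ℝ} (hβ : 0 ≤ β)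
    (ω : ℤˣ) (S : Finset ℤ) :
    Antitone fun L => gibbsExpectation α g β ω L (agree ω S) := by
  intro L L' hL
  have hsub : box L ⊆ box L' := by
    intro x hx
    rw [box, Finset.mem_Icc] at *
    omega
  simp only [gibbsExpectation_eq, agree_flipOn]
  rw [div_le_div_iff₀ (sum_weight_pos _ _ _ _ _) (sum_weight_pos _ _ _ _ _)]
  set w := weight α g β ((ω : ℤ) : ℝ)
  have hw : ∀ Λ, 0 ≤ w Λ := fun Λ => (weight_pos _ _ _ _ Λ).le
  have hw0 : (0 : Finset ℤ → ℝ) ≤ fun Λ => (if Disjoint Λ S then 1 else 0) * w Λ := by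
    intro Λ
    have := hw Λ
    simp only [Pi.zero_apply]
    split_ifs <;> simp [this]
  have h4 := four_functions_theorem (fun Λ => (if Disjoint Λ S then 1 else 0) * w Λ) w
    (fun Λ => (if Disjoint Λ S then 1 else 0) * w Λ) w hw0 hw hw0 hw (by
      intro A B
      by_cases hA : Disjoint A S
      · have hAB : Disjoint (A ⊓ B) S := hA.mono_left inf_le_left
        simp only [hA, hAB, if_true, one_mul]
        exact weight_mul_weight_le hα g hβ _ A B
      · simp only [hA, if_false, zero_mul]
        exact mul_nonneg (hw0 _) (hw _)) (box L').powerset (box L).powerset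
  have hinf : (box L').powerset ⊼ (box L).powerset = (box L).powerset := by
    ext A
    simp only [Finset.mem_infs, Finset.mem_powerset]
    constructor
    · rintro ⟨a, _, b, hb, rfl⟩
      exact Finset.inter_subset_right.trans hb
    · exact fun hA => ⟨A, hA.trans hsub, A, hA, inf_idem A⟩
  have hsup : (box L').powerset ⊻ (box L).powerset = (box L').powerset := by
    ext A
    simp only [Finset.mem_sups, Finset.mem_powerset]
    constructor
    · rintro ⟨a, ha, b, hb, rfl⟩
      exact Finset.union_subset ha (hb.trans hsub)
    · exact fun hA => ⟨A, hA, ∅, Finset.empty_subset _, sup_bot_eq A⟩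
  rw [hinf, hsup] at h4
  exact h4

theorem exists_tendsto_agree {α : ℝ} (hα : 1 < α) (g : ℤ → ℝ) {β : ℝ} (hβ : 0 ≤ β)
    (ω : ℤˣ) (S : Finset ℤ) :
    ∃ l, Filter.Tendsto (fun L => gibbsExpectation α g β ω L (agree ω S)) Filter.atTop
      (nhds l) := by
  refine ⟨_, tendsto_atTop_ciInf (gibbsExpectation_agree_anti hα g hβ ω S) ⟨0, ?_⟩⟩
  rintro _ ⟨L, rfl⟩
  simp only [gibbsExpectation_eq, agree_flipOn]
  refine div_nonneg (Finset.sum_nonneg fun Λ _ => ?_) (sum_weight_pos _ _ _ _ _).le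
  have := (weight_pos α g β ((ω : ℤ) : ℝ) Λ).le
  split_ifs <;> simp [this]

theorem exists_tendsto_of_dependsOn {α : ℝ} (hα : 1 < α) (g : ℤ → ℝ) {β : ℝ} (hβ : 0 ≤ β)
    (ω : ℤˣ) (Λ : Finset ℤ) : ∀ (f : Config → ℝ), DependsOn f (Λ : Set ℤ) → ∀ S : Finset ℤ,
    ∃ l, Filter.Tendsto (fun L => gibbsExpectation α g β ω L (fun σ => f σ * agree ω S σ))
      Filter.atTop (nhds l) := by
  induction Λ using Finset.induction_on with
  | empty =>
    intro f hf S
    obtain ⟨l, hl⟩ := exists_tendsto_agree hα g hβ ω S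
    have hc : ∀ σ, f σ = f (fun _ => ω) := fun σ => hf fun x hx => by simp at hx
    refine ⟨f (fun _ => ω) * l, ?_⟩
    have : ∀ L, gibbsExpectation α g β ω L (fun σ => f σ * agree ω S σ) =
        f (fun _ => ω) * gibbsExpectation α g β ω L (agree ω S) := fun L => by
      rw [← gibbsExpectation_const_mul]
      congr 1
      funext σ
      rw [hc σ]
    simp only [this]
    exact hl.const_mul _
  | insert a Λ ha ih =>
    intro f hf S
    have hdep : ∀ τ : ℤˣ, DependsOn (fun σ : Config => f (Function.update σ a τ)) (Λ : Set ℤ) := by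
      intro τ σ σ' h
      refine hf fun x hx => ?_
      by_cases hxa : x = a
      · subst hxa; simp
      · rw [Function.update_of_ne hxa, Function.update_of_ne hxa]
        refine h x ?_
        simpa [hxa] using hx
    obtain ⟨l1, h1⟩ := ih _ (hdep ω) (insert a S)
    obtain ⟨l2, h2⟩ := ih _ (hdep (-ω)) S
    obtain ⟨l3, h3⟩ := ih _ (hdep (-ω)) (insert a S)
    refine ⟨l1 + (l2 + -1 * l3), ?_⟩
    have : ∀ L, gibbsExpectation α g β ω L (fun σ => f σ * agree ω S σ) =
        gibbsExpectation α g β ω L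
            (fun σ => f (Function.update σ a ω) * agree ω (insert a S) σ) +
          (gibbsExpectation α g β ω L (fun σ => f (Function.update σ a (-ω)) * agree ω S σ) +
          -1 * gibbsExpectation α g β ω L
            (fun σ => f (Function.update σ a (-ω)) * agree ω (insert a S) σ)) := fun L => by
      rw [← gibbsExpectation_const_mul, ← gibbsExpectation_add, ← gibbsExpectation_add]
      congr 1
      funext σ
      rw [agree_insert]
      by_cases hσ : σ a = ω
      · have : Function.update σ a ω = σ := by rw [← hσ, Function.update_eq_self]
        rw [if_pos hσ, this]
        ring
      · have hσ' : σ a = -ω := by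
          rcases Int.units_eq_one_or ω with rfl | rfl <;>
            rcases Int.units_eq_one_or (σ a) with h | h <;> simp_all
        have : Function.update σ a (-ω) = σ := by rw [← hσ', Function.update_eq_self]
        rw [if_neg hσ, this]
        ring
    simp only [this]
    exact h1.add (h2.add (h3.const_mul _))

theorem exists_isBoundaryState {α : ℝ} (hα : 1 < α) (g : ℤ → ℝ) {β : ℝ} (hβ : 0 ≤ β) (ω : ℤˣ) :
    ∃ S, IsBoundaryState α g β ω S := by
  have h : ∀ f : Config → ℝ, ∃ l, IsLocal f →
      Filter.Tendsto (fun L => gibbsExpectation α g β ω L f) Filter.atTop (nhds l) := by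
    intro f
    by_cases hf : IsLocal f
    · obtain ⟨Λ, hΛ⟩ := hf
      obtain ⟨l, hl⟩ := exists_tendsto_of_dependsOn hα g hβ ω Λ f hΛ ∅
      refine ⟨l, fun _ => ?_⟩
      simpa [agree] using hl
    · exact ⟨0, fun h => absurd h hf⟩
  choose S hS using h
  exact ⟨S, hS⟩

theorem isLocal_spin (x : ℤ) : IsLocal (spin x) :=
  ⟨{x}, fun σ σ' h => by rw [spin, spin, h x (by simp)]⟩

/-! ### Phase transition -/

theorem half_le_mul_gibbsExpectation_spin {α : ℝ} {g : ℤ → ℝ} {β : ℝ} {ω : ℤˣ} {L : ℕ}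
    (h : ∑ Λ ∈ (box L).powerset.filter (0 ∈ ·), weight α g β ((ω : ℤ) : ℝ) Λ ≤
      1 / 4 * ∑ Λ ∈ (box L).powerset, weight α g β ((ω : ℤ) : ℝ) Λ) :
    1 / 2 ≤ ((ω : ℤ) : ℝ) * gibbsExpectation α g β ω L (spin 0) := by
  rw [gibbsExpectation_eq, ← mul_div_assoc, le_div_iff₀ (sum_weight_pos _ _ _ _ _),
    Finset.mul_sum _ _ ((ω : ℤ) : ℝ)]
  have hω := units_cast_mul_self ω
  have h1 : ∀ Λ ∈ (box L).powerset,
      ((ω : ℤ) : ℝ) * (spin 0 (flipOn ω Λ) * weight α g β ((ω : ℤ) : ℝ) Λ) =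
        weight α g β ((ω : ℤ) : ℝ) Λ -
          2 * if 0 ∈ Λ then weight α g β ((ω : ℤ) : ℝ) Λ else 0 := by
    intro Λ _
    rw [spin_flipOn, ← mul_assoc, ← mul_assoc, hω]
    split_ifs <;> ring
  rw [Finset.sum_congr rfl h1, Finset.sum_sub_distrib, ← Finset.mul_sum, ← Finset.sum_filter]
  linarith

end LongRangeIsing

theorem mainTheorem2 (α : ℝ) (hα1 : 1 < α) (hα2 : α ≤ 2)
    (h : ℤ → ℝ) (hh : ∀ x, 0 ≤ h x) (A : Finset ℤ) (η : ℝ) (hη0 : 0 < η) (hη1 : η < 1)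
    (hfield : ∀ Λ : Finset ℤ,
      ∑ x ∈ Λ, LongRangeIsing.truncate h A x ≤
        η * ∑ x ∈ Λ, ∑' y : {y : ℤ // y ∉ Λ}, |(x : ℝ) - ((y : ℤ) : ℝ)| ^ (-α)) :
    ∃ βbar : ℝ, 0 < βbar ∧ ∀ β : ℝ, βbar ≤ β →
      ∃ Sminus Splus : (LongRangeIsing.Config → ℝ) → ℝ,
        LongRangeIsing.IsBoundaryState α (LongRangeIsing.truncate h A) β (-1) Sminus ∧
        LongRangeIsing.IsBoundaryState α (LongRangeIsing.truncate h A) β 1 Splus ∧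
        Sminus (LongRangeIsing.spin 0) ≠ Splus (LongRangeIsing.spin 0) := by
  open LongRangeIsing in
  have hg : ∀ x, 0 ≤ truncate h A x := fun x => by
    unfold truncate
    split_ifs
    · exact le_rfl
    · exact hh x
  obtain ⟨βbar, hβbar, hP⟩ := exists_peierls_bound hα1 hα2 hg hη1 fun Λ => by
    rw [surface_eq_sum_tsum hα1]
    linarith [hfield Λ]
  refine ⟨βbar, hβbar, fun β hβ => ?_⟩
  have hβ0 : 0 ≤ β := hβbar.le.trans hβ
  obtain ⟨Sminus, hm⟩ := exists_isBoundaryState hα1 (truncate h A) hβ0 (-1)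
  obtain ⟨Splus, hp⟩ := exists_isBoundaryState hα1 (truncate h A) hβ0 1
  refine ⟨Sminus, Splus, hm, hp, ?_⟩
  have h1 : Sminus (spin 0) ≤ -(1 / 2) :=
    le_of_tendsto' (hm _ (isLocal_spin 0)) fun L => by
      have := half_le_mul_gibbsExpectation_spin (hP β hβ (((-1 : ℤˣ) : ℤ) : ℝ) (by simp) L)
      push_cast at this
      linarith
  have h2 : 1 / 2 ≤ Splus (spin 0) :=
    ge_of_tendsto' (hp _ (isLocal_spin 0)) fun L => by
      have := half_le_mul_gibbsExpectation_spin (hP β hβ (((1 : ℤˣ) : ℤ) : ℝ) (by simp) L)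
      simpa using this
  linarith
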